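/- For $d\ge 0$ let $H^2_d$ be the Drury--Arveson space: the completion of $\mathbb C[z_1,\dots,z_d]$ in the inner product for which distinct monomials are orthogonal and $\|z^\alpha\|^2=\alpha_1!\cdots\alpha_d!/|\alpha|!$. On $H^2_d\otimes\mathbb C^r$ let $Z_i$ be the bounded operator of multiplication by $z_i$ ($1\le i\le d$). For a homogeneous ideal or submodule of polynomials let $M$ be its closure in $H^2_d$ or $H^2_d\otimes\mathbb C^r$, and let $A_i=Z_i|_M$. It is called $p$-essentially normal if all commutators $[A_i,A_j^*]=A_iA_j^*-A_j^*A_i$ belong to the Schatten class $\mathcal L^p$, and essentially normal if they are all compact. Let $d,r\ge 0$ be integers. (1) Let $p>d+r$ be a real number. If every ideal of $\mathbb C[z_1,\dots,z_{d+r}]$ generated by quadratic forms (homogeneous polynomials of degree $2$) is $p$-essentially normal in $H^2_{d+r}$, then every submodule of $\mathbb C[z_1,\dots,z_d]\otimes\mathbb C^r$ generated by $\mathbb C^r$-valued linear forms (homogeneous of degree $1$) is $p$-essentially normal in $H^2_d\otimes\mathbb C^r$. (2) If every ideal of $\mathbb C[z_1,\dots,z_{d+r}]$ generated by quadratic forms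 is essentially normal in $H^2_{d+r}$, then every submodule of $\mathbb C[z_1,\dots,z_d]\otimes\mathbb C^r$ generated by $\mathbb C^r$-valued linear forms is essentially normal in $H^2_d\otimes\mathbb C^r$. In particular, if for every $n$ all ideals generated by quadratic forms are $p$-essentially normal in $H^2_n$ for all $p>n$, then for all $d,r$ all submodules generated by linear forms are $p$-essentially normal in $H^2_d\otimes\mathbb C^r$ for all $p>d+r$; and likewise for plain essential normality. -/

import Mathlib

/-!  The Drury-Arveson space, the d-shift, graded submodules and their essential normality.  -/

noncomputable section

/-- The squared norm `α₁! ⋯ α_d! / |α|!` of the monomial `z^α`. -/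
def daWeight {d : ℕ} (α : Fin d →₀ ℕ) : ℝ :=
  (∏ i, ((α i).factorial : ℝ)) / ((∑ i, α i).factorial : ℝ)

theorem daWeight_pos {d : ℕ} (α : Fin d →₀ ℕ) : 0 < daWeight α := by
  unfold daWeight
  have h : ∀ n : ℕ, (0 : ℝ) < (n.factorial : ℝ) := fun n => by exact_mod_cast n.factorial_pos
  exact div_pos (Finset.prod_pos fun i _ => h _) (h _)

theorem daWeight_single_add_le {d : ℕ} (i : Fin d) (α : Fin d →₀ ℕ) :
    daWeight (Finsupp.single i 1 + α) ≤ daWeight α := by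
  have h1 : (∏ j, (((Finsupp.single i 1 + α : Fin d →₀ ℕ) j).factorial : ℝ))
      = ((α i : ℝ) + 1) * ∏ j, ((α j).factorial : ℝ) := by
    rw [← Finset.mul_prod_erase _ _ (Finset.mem_univ i),
      ← Finset.mul_prod_erase Finset.univ (fun j => ((α j).factorial : ℝ)) (Finset.mem_univ i),
      ← mul_assoc]
    congr 1
    · simp [add_comm 1 (α i), Nat.factorial_succ]
    · refine Finset.prod_congr rfl fun j hj => ?_
      have : i ≠ j := (Finset.ne_of_mem_erase hj).symm
      simp [this]
  have h2 : (∑ j, (Finsupp.single i 1 + α : Fin d →₀ ℕ) j) = (∑ j, α j) + 1 := by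
    simp [Finset.sum_add_distrib, Finsupp.single_apply, add_comm]
  have h3 : α i ≤ ∑ j, α j :=
    Finset.single_le_sum (f := fun j => α j) (fun _ _ => Nat.zero_le _) (Finset.mem_univ i)
  have h4 : (α i : ℝ) ≤ ((∑ j, α j : ℕ) : ℝ) := by exact_mod_cast h3
  have hP : (0 : ℝ) ≤ ∏ j, ((α j).factorial : ℝ) := by positivity
  have hS : (0 : ℝ) < ((∑ j, α j).factorial : ℝ) := by exact_mod_cast Nat.factorial_pos _
  unfold daWeight
  rw [h1, h2, Nat.factorial_succ, div_le_div_iff₀ (by positivity) hS]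
  push_cast at h4 ⊢
  have : 0 ≤ (∏ j, ((α j).factorial : ℝ)) * ((∑ j, α j).factorial : ℝ) := by positivity
  nlinarith

/-- The polynomial algebra `ℂ[z₁, …, z_d]`, as the carrier of the `H²` inner product. -/
def DAPoly (d : ℕ) : Type := MvPolynomial (Fin d) ℂ

namespace DAPoly

instance (d : ℕ) : AddCommGroup (DAPoly d) := inferInstanceAs (AddCommGroup (MvPolynomial (Fin d) ℂ))

instance (d : ℕ) : Module ℂ (DAPoly d) := inferInstanceAs (Module ℂ (MvPolynomial (Fin d) ℂ))

/-- The identity map from polynomials to polynomials with the `H²` inner product. -/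
def of (d : ℕ) : MvPolynomial (Fin d) ℂ ≃ₗ[ℂ] DAPoly d := LinearEquiv.refl ℂ (MvPolynomial (Fin d) ℂ)

/-- The coefficient of `z^α`. -/
def coeff {d : ℕ} (α : Fin d →₀ ℕ) (f : DAPoly d) : ℂ := MvPolynomial.coeff α ((of d).symm f)

/-- The exponents of the monomials that occur in `f`. -/
def support {d : ℕ} (f : DAPoly d) : Finset (Fin d →₀ ℕ) := MvPolynomial.support ((of d).symm f)

/-- The `H²` inner product: monomials are orthogonal and `‖z^α‖² = daWeight α`. It is conjugate
linear in the first variable. -/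
def innerH2 {d : ℕ} (f g : DAPoly d) : ℂ :=
  ∑ α ∈ f.support, (starRingEnd ℂ) (f.coeff α) * g.coeff α * (daWeight α : ℂ)

theorem innerH2_eq {d : ℕ} (f g : DAPoly d) {s : Finset (Fin d →₀ ℕ)} (hs : f.support ⊆ s) :
    innerH2 f g = ∑ α ∈ s, (starRingEnd ℂ) (f.coeff α) * g.coeff α * (daWeight α : ℂ) := by
  refine Finset.sum_subset hs fun α _ hα => ?_
  have : f.coeff α = 0 := MvPolynomial.notMem_support_iff.mp hα
  simp [this]

theorem innerH2_self {d : ℕ} (f : DAPoly d) :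
    innerH2 f f = ((∑ α ∈ f.support, ‖f.coeff α‖ ^ 2 * daWeight α : ℝ) : ℂ) := by
  unfold innerH2
  push_cast
  refine Finset.sum_congr rfl fun α _ => ?_
  rw [Complex.conj_mul']

theorem coeff_add {d : ℕ} (α : Fin d →₀ ℕ) (f g : DAPoly d) :
    (f + g).coeff α = f.coeff α + g.coeff α := by
  simp [coeff]

theorem coeff_smul {d : ℕ} (α : Fin d →₀ ℕ) (c : ℂ) (f : DAPoly d) :
    (c • f).coeff α = c * f.coeff α := by
  simp [coeff]

theorem mem_support {d : ℕ} (α : Fin d →₀ ℕ) (f : DAPoly d) :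
    α ∈ f.support ↔ f.coeff α ≠ 0 := MvPolynomial.mem_support_iff

theorem ext {d : ℕ} {f g : DAPoly d} (h : ∀ α, f.coeff α = g.coeff α) : f = g :=
  (of d).symm.injective (MvPolynomial.ext _ _ h)

/-- The `H²` inner product on polynomials. -/
@[reducible] def core (d : ℕ) : InnerProductSpace.Core ℂ (DAPoly d) where
  inner f g := innerH2 f g
  conj_inner_symm f g := by
    rw [innerH2_eq f g (Finset.subset_union_left (s₂ := g.support)),
      innerH2_eq g f (Finset.subset_union_right (s₁ := f.support)), map_sum]
    refine Finset.sum_congr rfl fun α _ => ?_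
    simp [mul_comm]
  re_inner_nonneg f := by
    rw [innerH2_self]
    exact Finset.sum_nonneg fun α _ => mul_nonneg (by positivity) (daWeight_pos α).le
  add_left f g h := by
    classical
    have hsub : (f + g).support ⊆ f.support ∪ g.support := by
      intro α
      simp only [Finset.mem_union, mem_support, coeff_add]
      intro hα
      by_contra! hc
      exact hα (by rw [hc.1, hc.2, add_zero])
    rw [innerH2_eq (f + g) h hsub,
      innerH2_eq f h (Finset.subset_union_left (s₂ := g.support)),
      innerH2_eq g h (Finset.subset_union_right (s₁ := f.support)), ← Finset.sum_add_distrib]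
    refine Finset.sum_congr rfl fun α _ => ?_
    rw [coeff_add, map_add]
    ring
  smul_left f g c := by
    have hsub : (c • f).support ⊆ f.support := by
      intro α
      simp only [mem_support, coeff_smul]
      exact right_ne_zero_of_mul
    rw [innerH2_eq (c • f) g hsub, innerH2_eq f g (Finset.Subset.refl _), Finset.mul_sum]
    refine Finset.sum_congr rfl fun α _ => ?_
    rw [coeff_smul, map_mul]
    ring
  definite f hf := by
    rw [innerH2_self, Complex.ofReal_eq_zero, Finset.sum_eq_zero_iff_of_nonneg
      fun α _ => mul_nonneg (by positivity) (daWeight_pos α).le] at hf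
    refine ext fun α => ?_
    by_contra hne
    have h0 : f.coeff α ≠ 0 := hne
    have := hf α ((mem_support α f).mpr h0)
    have h1 : 0 < ‖f.coeff α‖ := norm_pos_iff.mpr h0
    have h2 := daWeight_pos α
    have : 0 < ‖f.coeff α‖ ^ 2 * daWeight α := by positivity
    linarith

instance (d : ℕ) : NormedAddCommGroup (DAPoly d) := (core d).toNormedAddCommGroup

instance (d : ℕ) : InnerProductSpace ℂ (DAPoly d) := InnerProductSpace.ofCore (core d).toCore

theorem norm_sq {d : ℕ} (f : DAPoly d) :
    ‖f‖ ^ 2 = ∑ α ∈ f.support, ‖f.coeff α‖ ^ 2 * daWeight α := by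
  rw [← inner_self_eq_norm_sq (𝕜 := ℂ) f]
  change RCLike.re (innerH2 f f) = _
  rw [innerH2_self]
  exact Complex.ofReal_re _

/-- Multiplication by `z_i` on polynomials. -/
def mulX {d : ℕ} (i : Fin d) : DAPoly d →ₗ[ℂ] DAPoly d :=
  (of d).toLinearMap ∘ₗ LinearMap.mulLeft ℂ (MvPolynomial.X i) ∘ₗ (of d).symm.toLinearMap

theorem norm_mulX_le {d : ℕ} (i : Fin d) (f : DAPoly d) : ‖mulX i f‖ ≤ 1 * ‖f‖ := by
  rw [one_mul]
  refine le_of_sq_le_sq ?_ (norm_nonneg f)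
  rw [norm_sq, norm_sq]
  have hs : (mulX i f).support = f.support.map (addLeftEmbedding (Finsupp.single i 1)) :=
    MvPolynomial.support_X_mul i ((of d).symm f)
  rw [hs, Finset.sum_map]
  refine Finset.sum_le_sum fun α _ => ?_
  have hc : (mulX i f).coeff (addLeftEmbedding (Finsupp.single i 1) α) = f.coeff α :=
    MvPolynomial.coeff_X_mul α i ((of d).symm f)
  rw [hc]
  exact mul_le_mul_of_nonneg_left (daWeight_single_add_le i α) (by positivity)

/-- Multiplication by `z_i` on polynomials, as a bounded operator for the `H²` norm. -/
def mulXL {d : ℕ} (i : Fin d) : DAPoly d →L[ℂ] DAPoly d :=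
  (mulX i).mkContinuous 1 (norm_mulX_le i)

end DAPoly

/-- The Drury-Arveson space `H²_d`: the completion of `ℂ[z₁, …, z_d]` in the `H²` norm. -/
abbrev DruryArveson (d : ℕ) : Type := UniformSpace.Completion (DAPoly d)

/-- The inclusion of the polynomials in `H²_d`. -/
def polyToH2 (d : ℕ) : MvPolynomial (Fin d) ℂ →ₗ[ℂ] DruryArveson d :=
  (UniformSpace.Completion.toComplL (𝕜 := ℂ) (E := DAPoly d)).toLinearMap ∘ₗ
    (DAPoly.of d).toLinearMap

/-- The `d`-shift on `H²_d`: the `i`-th operator is multiplication by `z_i`. -/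
def dShift (d : ℕ) (i : Fin d) : DruryArveson d →L[ℂ] DruryArveson d :=
  (DAPoly.mulXL i).completion

/-- `H²_d ⊗ ℂ^r`, as the Hilbert space direct sum of `r` copies of `H²_d`. -/
abbrev DruryArvesonMult (d r : ℕ) : Type := PiLp 2 (fun _ : Fin r => DruryArveson d)

/-- The inclusion of the `ℂ^r`-valued polynomials in `H²_d ⊗ ℂ^r`. -/
def polyToH2Mult (d r : ℕ) : (Fin r → MvPolynomial (Fin d) ℂ) →ₗ[ℂ] DruryArvesonMult d r where
  toFun f := WithLp.toLp 2 fun j => polyToH2 d (f j)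
  map_add' f g := by ext j; simp
  map_smul' c f := by ext j; simp

/-- The `d`-shift on `H²_d ⊗ ℂ^r`: the `i`-th operator is multiplication by `z_i` in every
component. -/
def dShiftMult (d r : ℕ) (i : Fin d) : DruryArvesonMult d r →L[ℂ] DruryArvesonMult d r :=
  (PiLp.continuousLinearEquiv 2 ℂ (fun _ : Fin r => DruryArveson d)).symm.toContinuousLinearMap ∘L
    (ContinuousLinearMap.pi fun j => (dShift d i) ∘L
      (PiLp.proj 2 (fun _ : Fin r => DruryArveson d) j : DruryArvesonMult d r →L[ℂ] DruryArveson d))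

/-- The closure in `H²_d` of an ideal of polynomials. -/
def idealClosure {d : ℕ} (I : Ideal (MvPolynomial (Fin d) ℂ)) : Submodule ℂ (DruryArveson d) :=
  ((I.restrictScalars ℂ).map (polyToH2 d)).topologicalClosure

/-- The closure in `H²_d ⊗ ℂ^r` of a module of `ℂ^r`-valued polynomials. -/
def moduleClosure {d r : ℕ}
    (N : Submodule (MvPolynomial (Fin d) ℂ) (Fin r → MvPolynomial (Fin d) ℂ)) :
    Submodule ℂ (DruryArvesonMult d r) :=
  ((N.restrictScalars ℂ).map (polyToH2Mult d r)).topologicalClosure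

instance {d : ℕ} (I : Ideal (MvPolynomial (Fin d) ℂ)) : CompleteSpace (idealClosure I) :=
  Submodule.topologicalClosure.completeSpace _

instance {d r : ℕ} (N : Submodule (MvPolynomial (Fin d) ℂ) (Fin r → MvPolynomial (Fin d) ℂ)) :
    CompleteSpace (moduleClosure N) :=
  Submodule.topologicalClosure.completeSpace _

/-- The ideal is generated by quadratic forms (homogeneous polynomials of degree two). -/
def IsQuadraticIdeal {d : ℕ} (I : Ideal (MvPolynomial (Fin d) ℂ)) : Prop :=
  ∃ G : Set (MvPolynomial (Fin d) ℂ), (∀ g ∈ G, g.IsHomogeneous 2) ∧ I = Ideal.span G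

/-- The module is generated by `ℂ^r`-valued linear forms (all components homogeneous of degree
one). -/
def IsLinearModule {d r : ℕ}
    (N : Submodule (MvPolynomial (Fin d) ℂ) (Fin r → MvPolynomial (Fin d) ℂ)) : Prop :=
  ∃ G : Set (Fin r → MvPolynomial (Fin d) ℂ),
    (∀ g ∈ G, ∀ j, (g j).IsHomogeneous 1) ∧ N = Submodule.span (MvPolynomial (Fin d) ℂ) G

section Operators

variable {H : Type*} [NormedAddCommGroup H] [InnerProductSpace ℂ H]

/-- The `n`-th singular number of a bounded operator on a Hilbert space (counted from `0`): its
distance in norm to the operators of rank at most `n`. For a compact operator these are the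
eigenvalues of `|T|` in decreasing order, with multiplicity. -/
def singularNumber (T : H →L[ℂ] H) (n : ℕ) : ℝ :=
  sInf {x : ℝ | ∃ F : H →L[ℂ] H, (F : H →ₗ[ℂ] H).rank ≤ (n : Cardinal) ∧ x = ‖T - F‖}

/-- Membership in the Schatten class `L^p` (for `p > 0`): the singular numbers are `p`-summable. -/
def InSchattenClass (p : ℝ) (T : H →L[ℂ] H) : Prop :=
  Summable fun n : ℕ => singularNumber T n ^ p

/-- The compression `P_M T|_M` of `T` to `M`; it is the restriction `T|_M` if `M` is invariant. -/
def compressTo (M : Submodule ℂ H) [M.HasOrthogonalProjection] (T : H →L[ℂ] H) : M →L[ℂ] M :=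
  M.orthogonalProjectionOnto ∘L T ∘L M.subtypeL

/-- The commutator `[A_i, A_j^*]`, where `A` is the compression of the tuple `T` to `M`. -/
def crossCommutator {ι : Type*} (T : ι → H →L[ℂ] H) (M : Submodule ℂ H) [CompleteSpace M]
    (i j : ι) : M →L[ℂ] M :=
  compressTo M (T i) ∘L ContinuousLinearMap.adjoint (compressTo M (T j)) -
    ContinuousLinearMap.adjoint (compressTo M (T j)) ∘L compressTo M (T i)

/-- `M` is `p`-essentially normal: all `[A_i, A_j^*]` are in `L^p`. -/
def IsPEssentiallyNormal {ι : Type*} (p : ℝ) (T : ι → H →L[ℂ] H) (M : Submodule ℂ H)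
    [CompleteSpace M] : Prop :=
  ∀ i j, InSchattenClass p (crossCommutator T M i j)

/-- `M` is essentially normal: all `[A_i, A_j^*]` are compact. -/
def IsEssentiallyNormal {ι : Type*} (T : ι → H →L[ℂ] H) (M : Submodule ℂ H)
    [CompleteSpace M] : Prop :=
  ∀ i j, IsCompactOperator (crossCommutator T M i j)

end Operators

end

/-! Let `N` be generated by a set `G` of vectors of linear forms in `z`. Adjoin variables `w_1, …,
w_r` and let `I` be the ideal generated by the quadratic forms `∑ j, g_j w_j`, for `g ∈ G`, and by
all products `w_j w_k`. In `w`-degree one, `I` is the copy of `N` under `f ↦ ∑ j, f_j w_j`; in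
`w`-degree zero it vanishes, and it contains everything of `w`-degree at least two.

Since `‖z^α w_j‖² = ‖z^α‖² / (|α| + 1)`, scaling this copy by `√(n+1)` in degree `n` gives an
isometry `V` (`attachIsometry`). It maps the closure `M` of `N` into the closure `L` of `I`, and
`V*` maps `L` back into `M`. It intertwines the shifts only up to a weight: `S_i V = V T_i D`, where
`D` is `√((n+1)/(n+2))` in degree `n`.

Write `A`, `C`, `W` for the restrictions of `T`, `S`, `V`. Then `W* [C_i, C_j*] W = A_i D² A_j* -
A_j* A_i D²`. Multiply on the right by `X = D⁻²`. As `A_j*` lowers the degree by one, `D² A_j* X =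
A_j* (1 - G)`, where the defect `G` (now an operator) is `1/(n+1)²` in degree `n`. Hence `[A_i,
A_j*] = W* [C_i, C_j*] W X + A_i A_j* G`, which is `exists_crossCommutator_moduleClosure_eq`.

There are at most `r k^d` vector monomials of degree below `k`, so `G` is in `L^p` for `p > d`
(`inSchattenClass_defectWeight`), and in particular compact. Both parts follow because `L^p` and the
compact operators are closed under sums and under multiplication by bounded operators. -/

noncomputable section

open ContinuousLinearMap
open scoped Pointwise

/-! ### Singular numbers and the ideal properties of Schatten classes -/

section SingularNumbers

universe u

variable {H K : Type u} [NormedAddCommGroup H] [InnerProductSpace ℂ H]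
  [NormedAddCommGroup K] [InnerProductSpace ℂ K]

theorem bddBelow_norm_sub_of_rank_le (T : H →L[ℂ] H) (n : ℕ) :
    BddBelow {x : ℝ | ∃ F : H →L[ℂ] H,
      (F : H →ₗ[ℂ] H).rank ≤ (n : Cardinal) ∧ x = ‖T - F‖} :=
  ⟨0, by rintro x ⟨F, -, rfl⟩; exact norm_nonneg _⟩

theorem singularNumber_nonneg (T : H →L[ℂ] H) (n : ℕ) : 0 ≤ singularNumber T n :=
  Real.sInf_nonneg (by rintro x ⟨F, -, rfl⟩; exact norm_nonneg _)

theorem singularNumber_le_norm_sub (T F : H →L[ℂ] H) {n : ℕ}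
    (hF : (F : H →ₗ[ℂ] H).rank ≤ (n : Cardinal)) : singularNumber T n ≤ ‖T - F‖ :=
  csInf_le (bddBelow_norm_sub_of_rank_le T n) ⟨F, hF, rfl⟩

theorem exists_norm_sub_lt_of_singularNumber_lt {T : H →L[ℂ] H} {n : ℕ} {x : ℝ}
    (h : singularNumber T n < x) :
    ∃ F : H →L[ℂ] H, (F : H →ₗ[ℂ] H).rank ≤ (n : Cardinal) ∧ ‖T - F‖ < x := by
  obtain ⟨y, ⟨F, hF, rfl⟩, hy⟩ := exists_lt_of_csInf_lt
    (s := {x : ℝ | ∃ F : H →L[ℂ] H, (F : H →ₗ[ℂ] H).rank ≤ (n : Cardinal) ∧ x = ‖T - F‖})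
    ⟨_, 0, by simp [LinearMap.rank_zero], rfl⟩ h
  exact ⟨F, hF, hy⟩

theorem singularNumber_antitone (T : H →L[ℂ] H) : Antitone (singularNumber T) := by
  intro m n hmn
  refine le_of_forall_gt_imp_ge_of_dense fun x hx => ?_
  obtain ⟨F, hF, hFx⟩ := exists_norm_sub_lt_of_singularNumber_lt hx
  exact (singularNumber_le_norm_sub T F (hF.trans (by exact_mod_cast hmn))).trans hFx.le

/-- Nearly optimal approximants of ranks `m` and `n` add up to one of rank at most `m + n`. -/
theorem singularNumber_add_le (S T : H →L[ℂ] H) (m n : ℕ) :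
    singularNumber (S + T) (m + n) ≤ singularNumber S m + singularNumber T n := by
  refine le_of_forall_pos_le_add fun ε hε => ?_
  obtain ⟨F, hF, hFx⟩ := exists_norm_sub_lt_of_singularNumber_lt
    (show singularNumber S m < singularNumber S m + ε / 2 by linarith)
  obtain ⟨G, hG, hGx⟩ := exists_norm_sub_lt_of_singularNumber_lt
    (show singularNumber T n < singularNumber T n + ε / 2 by linarith)
  have h1 : ((F + G : H →L[ℂ] H) : H →ₗ[ℂ] H).rank ≤ ((m + n : ℕ) : Cardinal) := by
    rw [ContinuousLinearMap.toLinearMap_add]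
    push_cast
    exact (LinearMap.rank_add_le _ _).trans (add_le_add hF hG)
  have h2 := singularNumber_le_norm_sub (S + T) (F + G) h1
  have h3 : ‖S + T - (F + G)‖ ≤ ‖S - F‖ + ‖T - G‖ := by
    rw [add_sub_add_comm]
    exact norm_add_le _ _
  linarith

theorem singularNumber_comp_le (X : H →L[ℂ] K) (T : H →L[ℂ] H) (Y : K →L[ℂ] H) (n : ℕ) :
    singularNumber (X ∘L T ∘L Y) n ≤ ‖X‖ * ‖Y‖ * singularNumber T n := by
  set c := ‖X‖ * ‖Y‖ with hc
  have hc0 : 0 ≤ c := by positivity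
  refine le_of_forall_pos_le_add fun ε hε => ?_
  -- The `+ 1` covers the case `c = 0`.
  have hδ : 0 < ε / (c + 1) := by positivity
  obtain ⟨F, hF, hFx⟩ := exists_norm_sub_lt_of_singularNumber_lt
    (show singularNumber T n < singularNumber T n + ε / (c + 1) by linarith)
  have h1 : ((X ∘L F ∘L Y : K →L[ℂ] K) : K →ₗ[ℂ] K).rank ≤ (n : Cardinal) :=
    (LinearMap.rank_comp_le_right (F.toLinearMap ∘ₗ Y.toLinearMap) X.toLinearMap).trans
      ((LinearMap.rank_comp_le_left Y.toLinearMap F.toLinearMap).trans hF)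
  have h2 := singularNumber_le_norm_sub (X ∘L T ∘L Y) _ h1
  have h3 : X ∘L T ∘L Y - X ∘L F ∘L Y = X ∘L (T - F) ∘L Y := by
    ext; simp
  have h4 : ‖X ∘L (T - F) ∘L Y‖ ≤ c * ‖T - F‖ := by
    calc _ ≤ ‖X‖ * (‖T - F‖ * ‖Y‖) :=
          (opNorm_comp_le _ _).trans (by gcongr; exact opNorm_comp_le _ _)
      _ = c * ‖T - F‖ := by rw [hc]; ring
  rw [h3] at h2
  have h5 : c * (ε / (c + 1)) ≤ ε := by
    rw [← mul_div_assoc, div_le_iff₀ (by positivity)]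
    nlinarith
  nlinarith [mul_le_mul_of_nonneg_left hFx.le hc0]

theorem summable_comp_div_two {f : ℕ → ℝ} (hf : Summable f) : Summable fun n => f (n / 2) := by
  have h1 : HasSum (fun k => f (2 * k / 2)) (∑' k, f k) := by
    simpa using hf.hasSum
  have h2 : HasSum (fun k => f ((2 * k + 1) / 2)) (∑' k, f k) := by
    have : ∀ k, (2 * k + 1) / 2 = k := fun k => by omega
    simpa [this] using hf.hasSum
  exact (HasSum.even_add_odd (f := fun n => f (n / 2)) h1 h2).summable

/-- Splitting the index `n` into two halves repeats each term of the bounding series twice. The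
crude bound `(a + b)^p ≤ 2^p (a^p + b^p)` holds for every `p > 0`, so no `ℓ^p` triangle inequality
is needed. -/
theorem InSchattenClass.add {p : ℝ} (hp : 0 < p) {S T : H →L[ℂ] H} (hS : InSchattenClass p S)
    (hT : InSchattenClass p T) : InSchattenClass p (S + T) := by
  have h := ((summable_comp_div_two hS).add (summable_comp_div_two hT)).mul_left ((2 : ℝ) ^ p)
  refine Summable.of_nonneg_of_le
    (fun n => Real.rpow_nonneg (singularNumber_nonneg _ _) _) (fun n => ?_) h
  set a := singularNumber S (n / 2)
  set b := singularNumber T (n / 2)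
  have ha : 0 ≤ a := singularNumber_nonneg _ _
  have hb : 0 ≤ b := singularNumber_nonneg _ _
  have h1 : singularNumber (S + T) n ≤ a + b :=
    (singularNumber_antitone _ (by omega : n / 2 + n / 2 ≤ n)).trans
      (singularNumber_add_le S T _ _)
  have h2 : singularNumber (S + T) n ≤ 2 * max a b := by
    linarith [le_max_left a b, le_max_right a b]
  calc singularNumber (S + T) n ^ p ≤ (2 * max a b) ^ p :=
        Real.rpow_le_rpow (singularNumber_nonneg _ _) h2 hp.le
    _ = 2 ^ p * max a b ^ p := Real.mul_rpow (by norm_num) (le_max_of_le_left ha)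
    _ ≤ 2 ^ p * (a ^ p + b ^ p) := by
        gcongr
        rcases max_choice a b with h | h <;> rw [h]
        · linarith [Real.rpow_nonneg hb p]
        · linarith [Real.rpow_nonneg ha p]

theorem InSchattenClass.comp {p : ℝ} (hp : 0 < p) {T : H →L[ℂ] H} (hT : InSchattenClass p T)
    (X : H →L[ℂ] K) (Y : K →L[ℂ] H) : InSchattenClass p (X ∘L T ∘L Y) := by
  refine Summable.of_nonneg_of_le
    (fun n => Real.rpow_nonneg (singularNumber_nonneg _ _) _) (fun n => ?_)
    (hT.mul_left ((‖X‖ * ‖Y‖) ^ p))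
  rw [← Real.mul_rpow (by positivity) (singularNumber_nonneg _ _)]
  exact Real.rpow_le_rpow (singularNumber_nonneg _ _) (singularNumber_comp_le X T Y n) hp.le

/-- The operator factors through its range, whose identity map is compact by finite dimension. -/
theorem isCompactOperator_of_rank_le {F : H →L[ℂ] H} {n : ℕ}
    (hF : (F : H →ₗ[ℂ] H).rank ≤ (n : Cardinal)) : IsCompactOperator F := by
  have : FiniteDimensional ℂ (F : H →ₗ[ℂ] H).range :=
    Module.rank_lt_aleph0_iff.mp (hF.trans_lt (Cardinal.natCast_lt_aleph0))
  have : ProperSpace (F : H →ₗ[ℂ] H).range := FiniteDimensional.proper ℂ _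
  have hid : IsCompactOperator (id ∘ F.rangeRestrict) :=
    ((isCompactOperator_id_iff_locallyCompactSpace).mpr inferInstance).comp_clm F.rangeRestrict
  exact hid.clm_comp (Submodule.subtypeL _)

/-- Summability forces the singular numbers to `0`, so `T` is a norm limit of operators of finite
rank. -/
theorem InSchattenClass.isCompactOperator [CompleteSpace H] {p : ℝ} (hp : 0 < p)
    {T : H →L[ℂ] H} (hT : InSchattenClass p T) : IsCompactOperator T := by
  have h0 : Filter.Tendsto (singularNumber T) Filter.atTop (nhds 0) := by
    have h := (Summable.tendsto_atTop_zero hT).rpow_const (p := p⁻¹) (Or.inr (by positivity))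
    rw [Real.zero_rpow (by positivity)] at h
    refine h.congr fun n => ?_
    rw [← Real.rpow_mul (singularNumber_nonneg _ _), mul_inv_cancel₀ hp.ne', Real.rpow_one]
  have h1 : ∀ n : ℕ, ∃ F : H →L[ℂ] H, (F : H →ₗ[ℂ] H).rank ≤ (n : Cardinal) ∧
      ‖T - F‖ < singularNumber T n + 1 / ((n : ℝ) + 1) := fun n =>
    exists_norm_sub_lt_of_singularNumber_lt (by
      have : (0 : ℝ) < 1 / ((n : ℝ) + 1) := by positivity
      linarith)
  choose F hF hFT using h1
  refine isCompactOperator_of_tendsto (F := F) (l := Filter.atTop) ?_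
    (Filter.Eventually.of_forall fun n => isCompactOperator_of_rank_le (hF n))
  rw [tendsto_iff_norm_sub_tendsto_zero]
  refine squeeze_zero (g := fun n : ℕ => singularNumber T n + 1 / ((n : ℝ) + 1))
    (fun _ => norm_nonneg _) (fun n => by rw [norm_sub_rev]; exact (hFT n).le) ?_
  simpa using h0.add (tendsto_one_div_add_atTop_nhds_zero_nat (𝕜 := ℝ))

end SingularNumbers

/-! ### Compressions and the commutator identity for weighted intertwiners -/

section Compression

variable {H K E : Type*} [NormedAddCommGroup H] [InnerProductSpace ℂ H]
  [NormedAddCommGroup K] [InnerProductSpace ℂ K] [NormedAddCommGroup E] [InnerProductSpace ℂ E]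

/-- The compression `P_L T|_M` of an operator `T : H → K` to subspaces `M` of `H` and `L` of
`K`. -/
def compressBetween (M : Submodule ℂ H) (L : Submodule ℂ K) [L.HasOrthogonalProjection]
    (T : H →L[ℂ] K) : M →L[ℂ] L :=
  L.orthogonalProjectionOnto ∘L T ∘L M.subtypeL

theorem compressTo_eq_compressBetween (M : Submodule ℂ H) [M.HasOrthogonalProjection]
    (T : H →L[ℂ] H) : compressTo M T = compressBetween M M T := rfl

/-- The inner projection acts as the identity on `T M ⊆ L`. Only the operator applied first has to
respect the subspaces; nothing is asked of `S`. -/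
theorem compressBetween_comp (M : Submodule ℂ H) (L : Submodule ℂ K) (P : Submodule ℂ E)
    [L.HasOrthogonalProjection] [P.HasOrthogonalProjection] (S : K →L[ℂ] E) {T : H →L[ℂ] K}
    (hT : ∀ x ∈ M, T x ∈ L) :
    compressBetween L P S ∘L compressBetween M L T = compressBetween M P (S ∘L T) := by
  ext x
  have h : ((L.orthogonalProjectionOnto (T x) : L) : K) = T x :=
    Submodule.starProjection_eq_self_iff.mpr (hT x x.2)
  simp [compressBetween, h]

theorem compressBetween_one (M : Submodule ℂ H) [M.HasOrthogonalProjection] :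
    compressBetween M M (1 : H →L[ℂ] H) = 1 := by
  ext x
  simp [compressBetween]

theorem compressBetween_add (M : Submodule ℂ H) (L : Submodule ℂ K) [L.HasOrthogonalProjection]
    (S T : H →L[ℂ] K) :
    compressBetween M L (S + T) = compressBetween M L S + compressBetween M L T := by
  ext x
  simp [compressBetween]

theorem adjoint_compressBetween [CompleteSpace H] [CompleteSpace K] (M : Submodule ℂ H)
    (L : Submodule ℂ K) [CompleteSpace M] [CompleteSpace L] (T : H →L[ℂ] K) :
    (compressBetween M L T).adjoint = compressBetween L M T.adjoint := by
  unfold compressBetween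
  rw [adjoint_comp, adjoint_comp, Submodule.adjoint_subtypeL,
    Submodule.adjoint_orthogonalProjectionOnto]
  rfl

/-- If an isometry `W` intertwines `C i` with `A i` weighted by `d`, where `x = d⁻²`, then the cross
commutator of `A` is that of `C` compressed along `W`, up to the factor `x` and a term containing
the defect `g` of the weights. -/
theorem cross_commutator_eq_of_weighted_intertwining [CompleteSpace H] [CompleteSpace K]
    {ι : Type*} (A : ι → H →L[ℂ] H) (C : ι → K →L[ℂ] K) (W : H →L[ℂ] K) (d d' x g : H →L[ℂ] H)
    (hWW : W.adjoint ∘L W = 1)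
    (hdadj : d.adjoint = d) (hdadj' : d'.adjoint = d') (hxadj : x.adjoint = x)
    (hgadj : g.adjoint = g)
    (hCW : ∀ i, C i ∘L W = W ∘L A i ∘L d)
    (hWC : ∀ i, W.adjoint ∘L C i = A i ∘L d ∘L W.adjoint)
    (hAd : ∀ i, A i ∘L d = d' ∘L A i) (hxd : x ∘L d ∘L d = 1)
    (hxg : ∀ i, x ∘L A i ∘L d ∘L d + g ∘L A i = A i) (i j : ι) :
    A i ∘L (A j).adjoint - (A j).adjoint ∘L A i =
      (W.adjoint ∘L (C i ∘L (C j).adjoint - (C j).adjoint ∘L C i) ∘L W) ∘L x +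
        (A i ∘L (A j).adjoint) ∘L g := by
  -- Taking adjoints turns the left inverse of `d²` into a right inverse.
  have hdx : d ∘L d ∘L x = 1 := by
    have := congrArg adjoint hxd
    simpa only [adjoint_comp, hdadj, hxadj, adjoint_one, comp_assoc] using this
  have hgx : d ∘L d ∘L (A j).adjoint ∘L x + (A j).adjoint ∘L g = (A j).adjoint := by
    have := congrArg adjoint (hxg j)
    simpa only [map_add, adjoint_comp, hdadj, hxadj, hgadj, comp_assoc] using this
  have hdA : d ∘L (A j).adjoint = (A j).adjoint ∘L d' := by
    have := congrArg adjoint (hAd j)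
    simpa only [adjoint_comp, hdadj, hdadj'] using this
  have hCWj : W.adjoint ∘L (C j).adjoint = d ∘L (A j).adjoint ∘L W.adjoint := by
    have := congrArg adjoint (hCW j)
    simpa only [adjoint_comp, hdadj, comp_assoc] using this
  have hWCj : (C j).adjoint ∘L W = W ∘L d ∘L (A j).adjoint := by
    have := congrArg adjoint (hWC j)
    simpa only [adjoint_comp, hdadj, comp_assoc, adjoint_adjoint] using this
  have h1 : W.adjoint ∘L (C i ∘L (C j).adjoint) ∘L W =
      A i ∘L d ∘L d ∘L (A j).adjoint := by
    calc _ = (W.adjoint ∘L C i) ∘L ((C j).adjoint ∘L W) := by simp only [comp_assoc]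
      _ = A i ∘L d ∘L (W.adjoint ∘L W) ∘L d ∘L (A j).adjoint := by
        rw [hWC, hWCj]; simp only [comp_assoc]
      _ = _ := by rw [hWW, one_def, id_comp]
  have h2 : W.adjoint ∘L ((C j).adjoint ∘L C i) ∘L W =
      (A j).adjoint ∘L A i ∘L d ∘L d := by
    calc _ = (W.adjoint ∘L (C j).adjoint) ∘L (C i ∘L W) := by simp only [comp_assoc]
      _ = d ∘L (A j).adjoint ∘L (W.adjoint ∘L W) ∘L A i ∘L d := by
        rw [hCW, hCWj]; simp only [comp_assoc]
      _ = (d ∘L (A j).adjoint) ∘L A i ∘L d := by rw [hWW, one_def, id_comp]; simp only [comp_assoc]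
      -- The left factor `d` becomes `d'` on passing `(A j)*` and turns back into `d` on passing `A
      -- i`.
      _ = (A j).adjoint ∘L (d' ∘L A i) ∘L d := by rw [hdA]; simp only [comp_assoc]
      _ = _ := by rw [← hAd]; simp only [comp_assoc]
  have h3 : W.adjoint ∘L (C i ∘L (C j).adjoint - (C j).adjoint ∘L C i) ∘L W =
      A i ∘L d ∘L d ∘L (A j).adjoint - (A j).adjoint ∘L A i ∘L d ∘L d := by
    rw [sub_comp, comp_sub, h1, h2]
  rw [h3, sub_comp]
  have h4 : A i ∘L (A j).adjoint =
      (A i ∘L d ∘L d ∘L (A j).adjoint) ∘L x + (A i ∘L (A j).adjoint) ∘L g := by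
    conv_lhs => rw [← hgx]
    rw [comp_add]; simp only [comp_assoc]
  have h5 : ((A j).adjoint ∘L A i ∘L d ∘L d) ∘L x = (A j).adjoint ∘L A i := by
    calc _ = (A j).adjoint ∘L A i ∘L (d ∘L d ∘L x) := by simp only [comp_assoc]
      _ = _ := by rw [hdx, one_def, comp_id]
  rw [h5]
  nth_rewrite 1 [h4]
  abel

/-- If an isometry `V` intertwines `S i` with `T i` up to the positive weight `D`, then the cross
commutator of `T` on `M` is obtained from that of `S` on `L` by multiplication with bounded operators,
up to a term containing the defect `G` of the weights. -/
theorem exists_crossCommutator_eq_of_weighted_intertwining [CompleteSpace H] [CompleteSpace K]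
    {ι κ : Type*} (T : ι → H →L[ℂ] H) (S : κ → K →L[ℂ] K) (e : ι → κ) (M : Submodule ℂ H)
    (L : Submodule ℂ K)
    [CompleteSpace M] [CompleteSpace L] (V : H →L[ℂ] K) (D D' X G : H →L[ℂ] H)
    (hV : V.adjoint ∘L V = 1) (hVM : ∀ x ∈ M, V x ∈ L) (hVL : ∀ y ∈ L, V.adjoint y ∈ M)
    (hTM : ∀ i, ∀ x ∈ M, T i x ∈ M) (hSL : ∀ i, ∀ y ∈ L, S i y ∈ L)
    (hDM : ∀ x ∈ M, D x ∈ M)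
    (hD : D.adjoint = D) (hD' : D'.adjoint = D') (hX : X.adjoint = X) (hG : G.adjoint = G)
    (hSV : ∀ i, S (e i) ∘L V = V ∘L T i ∘L D)
    (hVS : ∀ i, V.adjoint ∘L S (e i) = T i ∘L D ∘L V.adjoint)
    (hTD : ∀ i, T i ∘L D = D' ∘L T i) (hXD : X ∘L D ∘L D = 1)
    (hXG : ∀ i, X ∘L T i ∘L D ∘L D + G ∘L T i = T i) (i j : ι) :
    ∃ (W : M →L[ℂ] L) (Q : M →L[ℂ] M) (Y : H →L[ℂ] M), crossCommutator T M i j =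
      W.adjoint ∘L crossCommutator S L (e i) (e j) ∘L (W ∘L Q) + Y ∘L G ∘L M.subtypeL := by
  have hDDM : ∀ y ∈ M, (D ∘L D) y ∈ M := fun y hy => hDM _ (hDM y hy)
  have hTDM : ∀ i, ∀ y ∈ M, (T i ∘L D) y ∈ M := fun i y hy => hTM i _ (hDM y hy)
  have hTDDM : ∀ i, ∀ y ∈ M, (T i ∘L D ∘L D) y ∈ M := fun i y hy => hTM i _ (hDDM y hy)
  have hDVM : ∀ y ∈ L, (D ∘L V.adjoint) y ∈ M := fun y hy => hDM _ (hVL y hy)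
  -- `Y` ends in the projection onto `M`, so that `Y G` restricted to `M` is `A_i A_j*` times the
  -- compression of `G`. This leaves the uncompressed `G` in the formula, whose singular numbers can
  -- be estimated directly.
  refine ⟨compressBetween M L V, compressTo M X,
    (compressTo M (T i) ∘L (compressTo M (T j)).adjoint) ∘L M.orthogonalProjectionOnto, ?_⟩
  refine cross_commutator_eq_of_weighted_intertwining (fun i => compressTo M (T i))
    (fun i => compressTo L (S (e i))) (compressBetween M L V) (compressTo M D) (compressTo M D')
    (compressTo M X) (compressTo M G) ?_ ?_ ?_ ?_ ?_ ?_ ?_ ?_ ?_ ?_ i j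
  · rw [adjoint_compressBetween, compressBetween_comp _ _ _ _ hVM, hV, compressBetween_one]
  · rw [compressTo_eq_compressBetween, adjoint_compressBetween, hD]
  · rw [compressTo_eq_compressBetween, adjoint_compressBetween, hD']
  · rw [compressTo_eq_compressBetween, adjoint_compressBetween, hX]
  · rw [compressTo_eq_compressBetween, adjoint_compressBetween, hG]
  · intro i
    simp only [compressTo_eq_compressBetween]
    rw [compressBetween_comp _ _ _ _ hVM, compressBetween_comp _ _ _ _ hDM,
      compressBetween_comp _ _ _ _ (hTDM i), hSV]
  · intro i
    simp only [compressTo_eq_compressBetween]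
    rw [adjoint_compressBetween, compressBetween_comp _ _ _ _ (hSL _),
      compressBetween_comp _ _ _ _ hVL, compressBetween_comp _ _ _ _ hDVM, hVS]
  · intro i
    simp only [compressTo_eq_compressBetween]
    rw [compressBetween_comp _ _ _ _ hDM, compressBetween_comp _ _ _ _ (hTM i), hTD]
  · simp only [compressTo_eq_compressBetween]
    rw [compressBetween_comp _ _ _ _ hDM, compressBetween_comp _ _ _ _ hDDM, hXD,
      compressBetween_one]
  · intro i
    simp only [compressTo_eq_compressBetween]
    rw [compressBetween_comp _ _ _ _ hDM, compressBetween_comp _ _ _ _ hDDM,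
      compressBetween_comp _ _ _ _ (hTDDM i), compressBetween_comp _ _ _ _ (hTM i),
      ← compressBetween_add, hXG]

theorem isCompactOperator_comp_add_comp {F : Type*} [NormedAddCommGroup F]
    [InnerProductSpace ℂ F] {S : K →L[ℂ] K} {T : H →L[ℂ] H} (hS : IsCompactOperator S)
    (hT : IsCompactOperator T) (X : K →L[ℂ] F) (Y : E →L[ℂ] K) (X' : H →L[ℂ] F)
    (Y' : E →L[ℂ] H) : IsCompactOperator (X ∘L S ∘L Y + X' ∘L T ∘L Y' : E →L[ℂ] F) :=
  IsCompactOperator.add ((hS.comp_clm Y).clm_comp X) ((hT.comp_clm Y').clm_comp X')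

end Compression

/-! ### Diagonal operators in a Hilbert basis -/

section Diagonal

variable {ι H : Type*} [NormedAddCommGroup H] [InnerProductSpace ℂ H]

theorem HilbertBasis.clm_ext {F : Type*} [NormedAddCommGroup F] [NormedSpace ℂ F]
    (b : HilbertBasis ι ℂ H) {S T : H →L[ℂ] F} (h : ∀ i, S (b i) = T (b i)) : S = T := by
  refine ContinuousLinearMap.ext_on (s := Set.range b)
    (Submodule.dense_iff_topologicalClosure_eq_top.mpr b.dense_span) ?_
  rintro _ ⟨i, rfl⟩
  exact h i

theorem HilbertBasis.exists_diagonal (b : HilbertBasis ι ℂ H) (φ : ι → ℝ) {B : ℝ}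
    (hφ : ∀ i, |φ i| ≤ B) (hB : 0 ≤ B) :
    ∃ D : H →L[ℂ] H, (∀ i, D (b i) = (φ i : ℂ) • b i) ∧ ‖D‖ ≤ B := by
  classical
  have hn : ∀ i, ‖ContinuousLinearMap.mul ℂ ℂ (φ i : ℂ)‖ ≤ B := fun i =>
    (ContinuousLinearMap.opNorm_mul_apply_le ℂ ℂ _).trans (by simpa using hφ i)
  set Q := lp.mapCLM (E := fun _ : ι => ℂ) (F := fun _ : ι => ℂ) 2
    (fun i => ContinuousLinearMap.mul ℂ ℂ (φ i : ℂ)) hB hn with hQ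
  refine ⟨(b.repr.symm : _ →L[ℂ] H) ∘L Q ∘L (b.repr : H →L[ℂ] _), fun i => ?_, ?_⟩
  · change b.repr.symm (Q (b.repr (b i))) = _
    rw [LinearIsometryEquiv.symm_apply_eq, map_smul, b.repr_self]
    ext j
    rw [lp.coeFn_smul, Pi.smul_apply]
    rcases eq_or_ne j i with rfl | h
    · simp [hQ]
    · simp [hQ, h]
  · refine ContinuousLinearMap.opNorm_le_bound _ hB fun x => ?_
    have h1 : ‖Q (b.repr x)‖ ≤ B * ‖b.repr x‖ :=
      Q.le_of_opNorm_le (lp.norm_mapCLM_le _ _ _ _) _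
    simpa using h1

theorem HilbertBasis.adjoint_diagonal [CompleteSpace H] (b : HilbertBasis ι ℂ H) {φ : ι → ℝ}
    {D : H →L[ℂ] H} (hD : ∀ i, D (b i) = (φ i : ℂ) • b i) : D.adjoint = D := by
  classical
  refine b.clm_ext fun i => ?_
  refine b.repr.injective (lp.ext (funext fun j => ?_))
  rw [b.repr_apply_apply, b.repr_apply_apply, ContinuousLinearMap.adjoint_inner_right, hD, hD,
    inner_smul_left, inner_smul_right]
  have := orthonormal_iff_ite.mp b.orthonormal j i
  rw [this]
  split_ifs with h
  · simp [h]
  · simp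

theorem HilbertBasis.rank_diagonal_le (b : HilbertBasis ι ℂ H) {φ : ι → ℝ} {D : H →L[ℂ] H}
    (hD : ∀ i, D (b i) = (φ i : ℂ) • b i) (s : Finset ι) (hs : ∀ i ∉ s, φ i = 0) :
    (D : H →ₗ[ℂ] H).rank ≤ (s.card : Cardinal) := by
  classical
  have hsum : D = ∑ i ∈ s, (φ i : ℂ) • (innerSL ℂ (b i)).smulRight (b i) := by
    refine b.clm_ext fun j => ?_
    simp only [hD, sum_apply, smul_apply,
      ContinuousLinearMap.smulRight_apply, innerSL_apply_apply,
      orthonormal_iff_ite.mp b.orthonormal]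
    by_cases hj : j ∈ s
    · rw [Finset.sum_eq_single j] <;> simp +contextual [hj]
    · rw [Finset.sum_eq_zero]
      · simp [hs j hj]
      · intro i hi
        have : i ≠ j := fun h => hj (h ▸ hi)
        simp [this]
  have hrange : (D : H →ₗ[ℂ] H).range ≤ Submodule.span ℂ ((s.image b : Finset H) : Set H) := by
    rintro _ ⟨x, rfl⟩
    rw [hsum]
    simp only [ContinuousLinearMap.coe_coe, sum_apply,
      smul_apply, ContinuousLinearMap.smulRight_apply]
    refine Submodule.sum_mem _ fun i hi => Submodule.smul_mem _ _ (Submodule.smul_mem _ _ ?_)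
    exact Submodule.subset_span (by simpa using ⟨i, hi, rfl⟩)
  refine (Submodule.rank_mono hrange).trans ((rank_span_finset_le _).trans ?_)
  exact_mod_cast Finset.card_image_le

/-- The part of `D` on `s` has rank at most `s.card`, and what remains is diagonal with norm at most
`B`. -/
theorem HilbertBasis.singularNumber_diagonal_le (b : HilbertBasis ι ℂ H) {φ : ι → ℝ}
    {D : H →L[ℂ] H} (hD : ∀ i, D (b i) = (φ i : ℂ) • b i) (s : Finset ι) {n : ℕ}
    (hn : s.card ≤ n) {B : ℝ} (hB : 0 ≤ B) (hs : ∀ i ∉ s, |φ i| ≤ B) :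
    singularNumber D n ≤ B := by
  classical
  obtain ⟨F, hF, hFB⟩ := b.exists_diagonal (fun i => if i ∈ s then 0 else φ i) (B := B)
    (fun i => by split_ifs with h; · simpa using hB
                 · exact hs i h) hB
  have h1 : ∀ i, (D - F) (b i) = ((if i ∈ s then φ i else 0 : ℝ) : ℂ) • b i := fun i => by
    rw [sub_apply, hD, hF, ← sub_smul]
    split_ifs <;> simp
  have h2 := b.rank_diagonal_le h1 s (fun i hi => by simp [hi])
  refine (singularNumber_le_norm_sub D (D - F) (h2.trans (by exact_mod_cast hn))).trans ?_
  simpa using hFB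

end Diagonal

/-! ### Exponents and polynomials in the variables `(z, w)` -/

section Monomials

/-- The monomial `z^α` in `H²_d`. -/
def monomialH2 {d : ℕ} (α : Fin d →₀ ℕ) : DruryArveson d :=
  polyToH2 d (MvPolynomial.monomial α 1)

/-- The exponents of the monomial `z^α w_j`, where `z` are the first `d` and `w` are the last `r`
variables. -/
def attachExponent {d r : ℕ} (x : Fin r × (Fin d →₀ ℕ)) : Fin (d + r) →₀ ℕ :=
  x.2.mapDomain (Fin.castAdd r) + Finsupp.single (Fin.natAdd d x.1) 1

/-- The polynomial `∑ j, f_j w_j` in the variables `(z, w)` attached to a vector `f` of polynomials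
in `z`. -/
def attachPoly (d r : ℕ) :
    (Fin r → MvPolynomial (Fin d) ℂ) →ₗ[ℂ] MvPolynomial (Fin (d + r)) ℂ where
  toFun f := ∑ j, MvPolynomial.rename (Fin.castAdd r) (f j) * MvPolynomial.X (Fin.natAdd d j)
  map_add' f g := by simp [add_mul, Finset.sum_add_distrib]
  map_smul' c f := by simp [Finset.smul_sum]

variable {d r : ℕ}

theorem attachPoly_apply (f : Fin r → MvPolynomial (Fin d) ℂ) : attachPoly d r f =
    ∑ j, MvPolynomial.rename (Fin.castAdd r) (f j) * MvPolynomial.X (Fin.natAdd d j) := rfl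

/-- The vector valued monomial `z^α ⊗ e_j`. -/
def vectorMonomial (x : Fin r × (Fin d →₀ ℕ)) : Fin r → MvPolynomial (Fin d) ℂ :=
  Pi.single x.1 (MvPolynomial.monomial x.2 1)

theorem attachPoly_vectorMonomial (x : Fin r × (Fin d →₀ ℕ)) :
    attachPoly d r (vectorMonomial x) = MvPolynomial.monomial (attachExponent x) 1 := by
  rw [attachPoly_apply, Finset.sum_eq_single x.1]
  · simp [vectorMonomial, MvPolynomial.rename_monomial, MvPolynomial.X, MvPolynomial.monomial_mul,
      attachExponent]
  · intro j _ hj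
    simp [vectorMonomial, hj]
  · simp

theorem attachPoly_smul (p : MvPolynomial (Fin d) ℂ) (f : Fin r → MvPolynomial (Fin d) ℂ) :
    attachPoly d r (p • f) = MvPolynomial.rename (Fin.castAdd r) p * attachPoly d r f := by
  simp [attachPoly_apply, Finset.mul_sum, mul_assoc]

theorem attachExponent_castAdd (x : Fin r × (Fin d →₀ ℕ)) (i : Fin d) :
    attachExponent x (Fin.castAdd r i) = x.2 i := by
  have h : Fin.natAdd d x.1 ≠ Fin.castAdd r i := by
    intro h
    have := congrArg Fin.val h
    simp at this
    omega
  simp [attachExponent, h, Finsupp.mapDomain_apply (Fin.castAdd_injective d r)]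

theorem attachExponent_natAdd (x : Fin r × (Fin d →₀ ℕ)) (k : Fin r) :
    attachExponent x (Fin.natAdd d k) = if x.1 = k then 1 else 0 := by
  have h : Fin.natAdd d k ∉ Set.range (Fin.castAdd (n := d) r) := by
    rintro ⟨i, hi⟩
    have := congrArg Fin.val hi
    simp at this
    omega
  rw [attachExponent, Finsupp.add_apply, Finsupp.mapDomain_of_notMem_range _ _ h, zero_add,
    Finsupp.single_apply]
  simp

theorem attachExponent_injective :
    Function.Injective (attachExponent : Fin r × (Fin d →₀ ℕ) → (Fin (d + r) →₀ ℕ)) := by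
  rintro ⟨j, α⟩ ⟨k, β⟩ h
  have h1 : j = k := by
    have := DFunLike.congr_fun h (Fin.natAdd d k)
    rw [attachExponent_natAdd, attachExponent_natAdd] at this
    by_contra hne
    simp [hne] at this
  have h2 : α = β := by
    ext i
    have := DFunLike.congr_fun h (Fin.castAdd r i)
    rwa [attachExponent_castAdd, attachExponent_castAdd] at this
  rw [h1, h2]

/-- The factor `w_j` contributes only `1! = 1` to the numerator and raises the total degree by one.
This is the source of the factor `√(n+1)` in `attachIsometry`. -/
theorem daWeight_attachExponent (x : Fin r × (Fin d →₀ ℕ)) :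
    daWeight (attachExponent x) * ((x.2.degree : ℝ) + 1) = daWeight x.2 := by
  have h1 : ∏ i, ((attachExponent x i).factorial : ℝ) = ∏ i, ((x.2 i).factorial : ℝ) := by
    rw [Fin.prod_univ_add]
    simp only [attachExponent_castAdd, attachExponent_natAdd]
    rw [mul_eq_left₀ (Finset.prod_ne_zero_iff.mpr fun i _ => by positivity)]
    exact Finset.prod_eq_one fun i _ => by split_ifs <;> simp
  have h2 : ∑ i, attachExponent x i = x.2.degree + 1 := by
    rw [Fin.sum_univ_add]
    simp only [attachExponent_castAdd, attachExponent_natAdd]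
    simp [Finsupp.degree_eq_sum]
  unfold daWeight
  rw [h1, h2, ← Finsupp.degree_eq_sum, Nat.factorial_succ]
  push_cast
  have : ((x.2.degree).factorial : ℝ) ≠ 0 := by positivity
  have : ((x.2.degree : ℝ) + 1) ≠ 0 := by positivity
  field_simp

/-- The degree in the last `r` variables. -/
def lastDegree (γ : Fin (d + r) →₀ ℕ) : ℕ := ∑ k, γ (Fin.natAdd d k)

theorem lastDegree_add (γ δ : Fin (d + r) →₀ ℕ) :
    lastDegree (γ + δ) = lastDegree γ + lastDegree δ := by
  simp [lastDegree, Finset.sum_add_distrib]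

theorem lastDegree_single_natAdd (k : Fin r) :
    lastDegree (Finsupp.single (Fin.natAdd d k) 1 : Fin (d + r) →₀ ℕ) = 1 := by
  simp [lastDegree, Finsupp.single_apply]

theorem lastDegree_single_castAdd (i : Fin d) :
    lastDegree (Finsupp.single (Fin.castAdd r i) 1 : Fin (d + r) →₀ ℕ) = 0 := by
  refine Finset.sum_eq_zero fun k _ => ?_
  refine Finsupp.single_eq_of_ne fun h => ?_
  have := congrArg Fin.val h
  simp at this
  omega

theorem lastDegree_attachExponent (x : Fin r × (Fin d →₀ ℕ)) :
    lastDegree (attachExponent x) = 1 := by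
  simp [lastDegree, attachExponent_natAdd]

theorem exists_mapDomain_of_lastDegree_eq_zero {γ : Fin (d + r) →₀ ℕ} (h : lastDegree γ = 0) :
    ∃ α : Fin d →₀ ℕ, γ = α.mapDomain (Fin.castAdd r) := by
  refine ⟨γ.comapDomain (Fin.castAdd r) (Fin.castAdd_injective d r).injOn, ?_⟩
  ext i
  refine Fin.addCases (fun i => ?_) (fun k => ?_) i
  · rw [Finsupp.mapDomain_apply (Fin.castAdd_injective d r), Finsupp.comapDomain_apply]
  · have h1 : Fin.natAdd d k ∉ Set.range (Fin.castAdd (n := d) r) := by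
      rintro ⟨i, hi⟩
      have := congrArg Fin.val hi
      simp at this
      omega
    rw [Finsupp.mapDomain_of_notMem_range _ _ h1]
    exact (Finset.sum_eq_zero_iff.mp h) k (Finset.mem_univ k)

theorem exists_add_single_of_lastDegree_ne_zero {γ : Fin (d + r) →₀ ℕ} (h : lastDegree γ ≠ 0) :
    ∃ (k : Fin r) (δ : Fin (d + r) →₀ ℕ), γ = δ + Finsupp.single (Fin.natAdd d k) 1 := by
  obtain ⟨k, -, hk⟩ := Finset.exists_ne_zero_of_sum_ne_zero h
  refine ⟨k, γ - Finsupp.single (Fin.natAdd d k) 1, (tsub_add_cancel_of_le ?_).symm⟩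
  rw [Finsupp.single_le_iff]
  omega

theorem exists_attachExponent_of_lastDegree_eq_one {γ : Fin (d + r) →₀ ℕ} (h : lastDegree γ = 1) :
    ∃ x : Fin r × (Fin d →₀ ℕ), γ = attachExponent x := by
  obtain ⟨k, δ, rfl⟩ := exists_add_single_of_lastDegree_ne_zero (by omega : lastDegree γ ≠ 0)
  rw [lastDegree_add, lastDegree_single_natAdd] at h
  obtain ⟨α, rfl⟩ := exists_mapDomain_of_lastDegree_eq_zero (by omega : lastDegree δ = 0)
  exact ⟨(k, α), rfl⟩

theorem map_eq_of_isHomogeneous {Y : Type*} [AddCommGroup Y] [Module ℂ Y]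
    {Φ Ψ : (Fin r → MvPolynomial (Fin d) ℂ) →ₗ[ℂ] Y} {n : ℕ}
    (h : ∀ x : Fin r × (Fin d →₀ ℕ), x.2.degree = n → Φ (vectorMonomial x) = Ψ (vectorMonomial x))
    {f : Fin r → MvPolynomial (Fin d) ℂ} (hf : ∀ j, (f j).IsHomogeneous n) : Φ f = Ψ f := by
  classical
  have h1 : f = ∑ j, ∑ α ∈ (f j).support, (f j).coeff α • vectorMonomial (j, α) := by
    conv_lhs => rw [← Finset.univ_sum_single f]
    refine Finset.sum_congr rfl fun j _ => ?_
    conv_lhs => rw [(f j).as_sum]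
    rw [← LinearMap.single_apply ℂ, map_sum]
    refine Finset.sum_congr rfl fun α _ => ?_
    rw [← mul_one ((f j).coeff α), ← smul_eq_mul, ← MvPolynomial.smul_monomial, map_smul]
    simp [vectorMonomial]
  rw [h1]
  simp only [map_sum, map_smul]
  refine Finset.sum_congr rfl fun j _ => Finset.sum_congr rfl fun α hα => ?_
  rw [h (j, α) (by
    rw [Finsupp.degree_eq_weight_one]
    exact hf j (MvPolynomial.mem_support_iff.mp hα))]

theorem linearMap_ext_vectorMonomial {Y : Type*} [AddCommGroup Y] [Module ℂ Y]
    {Φ Ψ : (Fin r → MvPolynomial (Fin d) ℂ) →ₗ[ℂ] Y}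
    (h : ∀ x : Fin r × (Fin d →₀ ℕ), Φ (vectorMonomial x) = Ψ (vectorMonomial x)) : Φ = Ψ := by
  refine LinearMap.pi_ext' fun j => (MvPolynomial.basisMonomials (Fin d) ℂ).ext fun α => ?_
  simpa [vectorMonomial] using h (j, α)

/-- The span over the polynomial ring is the `ℂ`-span of the monomial multiples of `G`. For
homogeneous generators these multiples are homogeneous, so operators depending on the degree can be
tested on them without splitting elements into components. -/
theorem map_mem_of_mem_span {σ Mod Y : Type*} [AddCommGroup Mod] [Module (MvPolynomial σ ℂ) Mod]
    [Module ℂ Mod] [IsScalarTower ℂ (MvPolynomial σ ℂ) Mod] [AddCommGroup Y] [Module ℂ Y]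
    (Φ : Mod →ₗ[ℂ] Y) (P : Submodule ℂ Y) {G : Set Mod}
    (h : ∀ α : σ →₀ ℕ, ∀ g ∈ G, Φ ((MvPolynomial.monomial α (1 : ℂ)) • g) ∈ P) {f : Mod}
    (hf : f ∈ Submodule.span (MvPolynomial σ ℂ) G) : Φ f ∈ P := by
  have h1 := Submodule.span_smul_of_span_eq_top (MvPolynomial.basisMonomials σ ℂ).span_eq G
  have h2 : f ∈ Submodule.span ℂ (Set.range (MvPolynomial.basisMonomials σ ℂ) • G) := by
    rw [h1]; exact hf
  have h3 : Submodule.span ℂ (Set.range (MvPolynomial.basisMonomials σ ℂ) • G) ≤ P.comap Φ := by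
    rw [Submodule.span_le]
    rintro _ ⟨_, ⟨α, rfl⟩, g, hg, rfl⟩
    simpa using h α g hg
  exact h3 h2

end Monomials

/-! ### Monomial bases of the Hilbert spaces and operators diagonal in the degree -/

section Spaces

variable {d r : ℕ}

theorem denseRange_polyToH2 : DenseRange (polyToH2 d) :=
  UniformSpace.Completion.denseRange_coe (α := DAPoly d)

theorem inner_monomialH2 (α β : Fin d →₀ ℕ) :
    inner ℂ (monomialH2 α) (monomialH2 β) = if α = β then (daWeight α : ℂ) else 0 := by
  classical
  have h1 : inner ℂ (monomialH2 α) (monomialH2 β) =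
      DAPoly.innerH2 (DAPoly.of d (MvPolynomial.monomial α 1))
        (DAPoly.of d (MvPolynomial.monomial β 1)) :=
    UniformSpace.Completion.inner_coe (E := DAPoly d) _ _
  have h2 : (DAPoly.of d (MvPolynomial.monomial α 1)).support ⊆ {α} :=
    MvPolynomial.support_monomial_subset
  rw [h1, DAPoly.innerH2_eq _ _ h2, Finset.sum_singleton]
  have h3 : ∀ γ : Fin d →₀ ℕ, (DAPoly.of d (MvPolynomial.monomial γ 1)).coeff α =
      if γ = α then 1 else 0 := fun γ => MvPolynomial.coeff_monomial α γ 1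
  rw [h3, h3]
  by_cases h : α = β
  · simp [h]
  · simp [h, Ne.symm h]

theorem dShift_polyToH2 (i : Fin d) (f : MvPolynomial (Fin d) ℂ) :
    dShift d i (polyToH2 d f) = polyToH2 d (MvPolynomial.X i * f) :=
  ContinuousLinearMap.completion_apply_coe (DAPoly.mulXL i) (DAPoly.of d f)

theorem dShift_monomialH2 (i : Fin d) (α : Fin d →₀ ℕ) :
    dShift d i (monomialH2 α) = monomialH2 (α + Finsupp.single i 1) := by
  rw [monomialH2, dShift_polyToH2, monomialH2, MvPolynomial.X, MvPolynomial.monomial_mul, one_mul,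
    add_comm]

theorem clm_ext_monomialH2 {F : Type*} [NormedAddCommGroup F] [NormedSpace ℂ F]
    {S T : DruryArveson d →L[ℂ] F} (h : ∀ α, S (monomialH2 α) = T (monomialH2 α)) : S = T := by
  have h1 : S.toLinearMap ∘ₗ polyToH2 d = T.toLinearMap ∘ₗ polyToH2 d :=
    (MvPolynomial.basisMonomials (Fin d) ℂ).ext fun α => by simpa [monomialH2] using h α
  exact DFunLike.coe_injective (denseRange_polyToH2.equalizer S.continuous T.continuous
    (funext fun f => DFunLike.congr_fun h1 f))

theorem polyToH2Mult_apply (f : Fin r → MvPolynomial (Fin d) ℂ) (j : Fin r) :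
    polyToH2Mult d r f j = polyToH2 d (f j) := rfl

theorem denseRange_polyToH2Mult : DenseRange (polyToH2Mult d r) :=
  ((PiLp.continuousLinearEquiv 2 ℂ
    (fun _ : Fin r => DruryArveson d)).symm.surjective.denseRange).comp
    (DenseRange.piMap fun _ : Fin r => denseRange_polyToH2 (d := d))
    (PiLp.continuousLinearEquiv 2 ℂ (fun _ : Fin r => DruryArveson d)).symm.continuous

theorem dShiftMult_polyToH2Mult (i : Fin d) (f : Fin r → MvPolynomial (Fin d) ℂ) :
    dShiftMult d r i (polyToH2Mult d r f) =
      polyToH2Mult d r ((MvPolynomial.X i : MvPolynomial (Fin d) ℂ) • f) := by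
  ext j
  exact dShift_polyToH2 i (f j)

theorem smul_vectorMonomial (i : Fin d) (x : Fin r × (Fin d →₀ ℕ)) :
    (MvPolynomial.X i : MvPolynomial (Fin d) ℂ) • vectorMonomial x =
      vectorMonomial (x.1, x.2 + Finsupp.single i 1) := by
  rw [vectorMonomial, ← Pi.single_smul, smul_eq_mul, MvPolynomial.X, MvPolynomial.monomial_mul,
    one_mul, add_comm, vectorMonomial]

/-- The vector valued monomial `z^α ⊗ e_j` in `H²_d ⊗ ℂ^r`. -/
def monomialH2Mult (x : Fin r × (Fin d →₀ ℕ)) : DruryArvesonMult d r :=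
  polyToH2Mult d r (vectorMonomial x)

theorem inner_monomialH2Mult (x y : Fin r × (Fin d →₀ ℕ)) :
    inner ℂ (monomialH2Mult x) (monomialH2Mult y) = if x = y then (daWeight x.2 : ℂ) else 0 := by
  classical
  rw [PiLp.inner_apply]
  have h : ∀ (x : Fin r × (Fin d →₀ ℕ)) (j : Fin r),
      monomialH2Mult x j = if j = x.1 then monomialH2 x.2 else 0 := fun x j => by
    rw [monomialH2Mult, polyToH2Mult_apply, vectorMonomial, Pi.single_apply]
    split_ifs <;> simp [monomialH2]
  simp only [h]
  rw [Finset.sum_eq_single x.1 (fun j _ hj => by simp [hj]) (by simp)]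
  rw [if_pos rfl]
  by_cases h1 : x.1 = y.1
  · rw [if_pos h1, inner_monomialH2]
    simp [Prod.ext_iff, h1]
  · rw [if_neg h1, if_neg (fun h => h1 (congrArg Prod.fst h)), inner_zero_right]

theorem orthonormal_of_inner_eq {E ι : Type*} [NormedAddCommGroup E] [InnerProductSpace ℂ E]
    [DecidableEq ι] {v : ι → E} {w : ι → ℝ} (hw : ∀ i, 0 < w i)
    (hv : ∀ i j, inner ℂ (v i) (v j) = if i = j then (w i : ℂ) else 0) :
    Orthonormal ℂ fun i => (((Real.sqrt (w i))⁻¹ : ℝ) : ℂ) • v i := by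
  rw [orthonormal_iff_ite]
  intro i j
  rw [inner_smul_left, inner_smul_right, hv]
  split_ifs with h
  · subst h
    rw [Complex.conj_ofReal]
    norm_cast
    have := Real.mul_self_sqrt (hw i).le
    have h0 : Real.sqrt (w i) ≠ 0 := (Real.sqrt_pos.mpr (hw i)).ne'
    conv_lhs => rw [← this]
    field_simp
    rw [Real.sqrt_sq (Real.sqrt_nonneg _)]
  · simp

theorem orthonormal_monomialH2Mult : Orthonormal ℂ fun x : Fin r × (Fin d →₀ ℕ) =>
    (((Real.sqrt (daWeight x.2))⁻¹ : ℝ) : ℂ) • monomialH2Mult x := by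
  classical
  exact orthonormal_of_inner_eq (fun x => daWeight_pos x.2) fun x y => by
    rw [inner_monomialH2Mult]

/-- The Hilbert basis of `H²_d ⊗ ℂ^r` of normalized monomials. -/
def multBasis (d r : ℕ) : HilbertBasis (Fin r × (Fin d →₀ ℕ)) ℂ (DruryArvesonMult d r) :=
  HilbertBasis.mk orthonormal_monomialH2Mult <| by
    rw [top_le_iff, ← Submodule.dense_iff_topologicalClosure_eq_top]
    refine denseRange_polyToH2Mult.mono ?_
    rintro _ ⟨f, rfl⟩
    set P := Submodule.span ℂ (Set.range fun x : Fin r × (Fin d →₀ ℕ) =>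
      (((Real.sqrt (daWeight x.2))⁻¹ : ℝ) : ℂ) • monomialH2Mult x) with hP
    -- Membership in `P` is phrased as the vanishing of a linear map, which can be checked on vector
    -- monomials.
    have h : P.mkQ ∘ₗ polyToH2Mult d r = 0 := by
      refine linearMap_ext_vectorMonomial fun x => ?_
      rw [LinearMap.comp_apply, LinearMap.zero_apply, Submodule.mkQ_apply,
        Submodule.Quotient.mk_eq_zero]
      have h1 : (((Real.sqrt (daWeight x.2))⁻¹ : ℝ) : ℂ) • monomialH2Mult x ∈ P :=
        Submodule.subset_span ⟨x, rfl⟩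
      refine (Submodule.smul_mem_iff P ?_).mp h1
      have := (Real.sqrt_pos.mpr (daWeight_pos x.2)).ne'
      exact_mod_cast inv_ne_zero this
    have := DFunLike.congr_fun h f
    rwa [LinearMap.comp_apply, LinearMap.zero_apply, Submodule.mkQ_apply,
      Submodule.Quotient.mk_eq_zero] at this

theorem multBasis_apply (x : Fin r × (Fin d →₀ ℕ)) : multBasis d r x =
    (((Real.sqrt (daWeight x.2))⁻¹ : ℝ) : ℂ) • monomialH2Mult x := by
  rw [multBasis, HilbertBasis.coe_mk]

theorem monomialH2Mult_eq (x : Fin r × (Fin d →₀ ℕ)) :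
    monomialH2Mult x = ((Real.sqrt (daWeight x.2) : ℝ) : ℂ) • multBasis d r x := by
  rw [multBasis_apply, smul_smul, ← Complex.ofReal_mul, mul_inv_cancel₀
    (Real.sqrt_pos.mpr (daWeight_pos x.2)).ne', Complex.ofReal_one, one_smul]

theorem clm_ext_monomialH2Mult {F : Type*} [NormedAddCommGroup F] [NormedSpace ℂ F]
    {S T : DruryArvesonMult d r →L[ℂ] F}
    (h : ∀ x, S (monomialH2Mult x) = T (monomialH2Mult x)) : S = T := by
  refine (multBasis d r).clm_ext fun x => ?_
  rw [multBasis_apply, map_smul, map_smul, h]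

theorem dShiftMult_monomialH2Mult (i : Fin d) (x : Fin r × (Fin d →₀ ℕ)) :
    dShiftMult d r i (monomialH2Mult x) = monomialH2Mult (x.1, x.2 + Finsupp.single i 1) := by
  rw [monomialH2Mult, dShiftMult_polyToH2Mult, smul_vectorMonomial, monomialH2Mult]

theorem exists_degreeDiagonal (d r : ℕ) (φ : ℕ → ℝ) {B : ℝ} (hφ : ∀ n, |φ n| ≤ B) :
    ∃ D : DruryArvesonMult d r →L[ℂ] DruryArvesonMult d r,
      ∀ x, D (monomialH2Mult x) = (φ x.2.degree : ℂ) • monomialH2Mult x := by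
  obtain ⟨D, hD, -⟩ := (multBasis d r).exists_diagonal (fun x => φ x.2.degree)
    (fun x => hφ _) ((abs_nonneg _).trans (hφ 0))
  refine ⟨D, fun x => ?_⟩
  rw [monomialH2Mult_eq, map_smul, hD, smul_comm]

/-- The operator on `H²_d ⊗ ℂ^r` that multiplies polynomials of degree `n` by `φ n`. -/
def degreeDiagonal (d r : ℕ) (φ : ℕ → ℝ) {B : ℝ} (hφ : ∀ n, |φ n| ≤ B) :
    DruryArvesonMult d r →L[ℂ] DruryArvesonMult d r :=
  (exists_degreeDiagonal d r φ hφ).choose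

theorem degreeDiagonal_monomialH2Mult {φ : ℕ → ℝ} {B : ℝ} (hφ : ∀ n, |φ n| ≤ B)
    (x : Fin r × (Fin d →₀ ℕ)) :
    degreeDiagonal d r φ hφ (monomialH2Mult x) = (φ x.2.degree : ℂ) • monomialH2Mult x :=
  (exists_degreeDiagonal d r φ hφ).choose_spec x

theorem degreeDiagonal_multBasis {φ : ℕ → ℝ} {B : ℝ} (hφ : ∀ n, |φ n| ≤ B)
    (x : Fin r × (Fin d →₀ ℕ)) :
    degreeDiagonal d r φ hφ (multBasis d r x) = (φ x.2.degree : ℂ) • multBasis d r x := by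
  rw [multBasis_apply, map_smul, degreeDiagonal_monomialH2Mult, smul_comm]

theorem adjoint_degreeDiagonal {φ : ℕ → ℝ} {B : ℝ} (hφ : ∀ n, |φ n| ≤ B) :
    (degreeDiagonal d r φ hφ).adjoint = degreeDiagonal d r φ hφ :=
  (multBasis d r).adjoint_diagonal (degreeDiagonal_multBasis hφ)

theorem degreeDiagonal_polyToH2Mult {φ : ℕ → ℝ} {B : ℝ} (hφ : ∀ n, |φ n| ≤ B) {n : ℕ}
    {f : Fin r → MvPolynomial (Fin d) ℂ} (hf : ∀ j, (f j).IsHomogeneous n) :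
    degreeDiagonal d r φ hφ (polyToH2Mult d r f) = (φ n : ℂ) • polyToH2Mult d r f :=
  map_eq_of_isHomogeneous (Φ := (degreeDiagonal d r φ hφ).toLinearMap ∘ₗ polyToH2Mult d r)
    (Ψ := (φ n : ℂ) • polyToH2Mult d r)
    (fun x hx => by rw [← hx]; exact degreeDiagonal_monomialH2Mult hφ x) hf

/-- The shift raises the degree by one. The value `ψ 0` is free, since no shifted monomial has
degree `0`. -/
theorem dShiftMult_comp_degreeDiagonal {φ ψ : ℕ → ℝ} {B C : ℝ} (hφ : ∀ n, |φ n| ≤ B)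
    (hψ : ∀ n, |ψ n| ≤ C) (h : ∀ n, ψ (n + 1) = φ n) (i : Fin d) :
    dShiftMult d r i ∘L degreeDiagonal d r φ hφ = degreeDiagonal d r ψ hψ ∘L dShiftMult d r i := by
  refine clm_ext_monomialH2Mult fun x => ?_
  rw [comp_apply, comp_apply, degreeDiagonal_monomialH2Mult, map_smul, dShiftMult_monomialH2Mult,
    degreeDiagonal_monomialH2Mult, map_add, Finsupp.degree_single, h]

theorem singularNumber_degreeDiagonal_le {φ : ℕ → ℝ} {B : ℝ} (hφ : ∀ n, |φ n| ≤ B)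
    (hanti : Antitone φ) (h0 : ∀ n, 0 ≤ φ n) {k n : ℕ} (hn : r * k ^ d ≤ n) :
    singularNumber (degreeDiagonal d r φ hφ) n ≤ φ k := by
  classical
  -- The box of exponents with all entries below `k` has `k ^ d` elements; outside it some entry,
  -- hence the degree, is at least `k`.
  set s : Finset (Fin r × (Fin d →₀ ℕ)) := Finset.univ ×ˢ
    ((Fintype.piFinset fun _ : Fin d => Finset.range k).map
      Finsupp.equivFunOnFinite.symm.toEmbedding) with hs
  refine (multBasis d r).singularNumber_diagonal_le (degreeDiagonal_multBasis hφ) s ?_ (h0 k) ?_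
  · refine le_trans (le_of_eq ?_) hn
    simp [hs, Finset.card_product]
  · intro x hx
    rw [abs_of_nonneg (h0 _)]
    refine hanti ?_
    by_contra! hlt
    refine hx ?_
    simp only [hs, Finset.mem_product, Finset.mem_univ, true_and, Finset.mem_map_equiv,
      Equiv.symm_symm, Fintype.mem_piFinset, Finset.mem_range]
    intro i
    refine lt_of_le_of_lt ?_ hlt
    rw [Finsupp.degree_eq_sum]
    exact Finset.single_le_sum (f := fun j => x.2 j) (fun _ _ => Nat.zero_le _) (Finset.mem_univ i)

/-- With `k` about `(n/(r+1))^(1/d)`, the `n`-th singular number is at most `1/(k+1)`, hence of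
order `n^(-1/d)`. Its `p`-th powers are summable because `p/d > 1`. -/
theorem inSchattenClass_degreeDiagonal (hd : 0 < d) {p : ℝ} (hp : (d : ℝ) < p) {φ : ℕ → ℝ} {B : ℝ}
    (hφ : ∀ n, |φ n| ≤ B) (hanti : Antitone φ) (h0 : ∀ n, 0 ≤ φ n)
    (h1 : ∀ n, φ n ≤ 1 / ((n : ℝ) + 1)) :
    InSchattenClass p (degreeDiagonal d r φ hφ) := by
  have hd' : (0 : ℝ) < d := by exact_mod_cast hd
  have hp0 : 0 < p := hd'.trans hp
  have hsum : Summable fun n : ℕ => ((r : ℝ) + 1) ^ (p / d) * (1 / (n : ℝ) ^ (p / d)) :=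
    (Real.summable_one_div_nat_rpow.mpr ((one_lt_div hd').mpr hp)).mul_left _
  refine Summable.of_norm_bounded_eventually_nat hsum ?_
  filter_upwards [Filter.eventually_gt_atTop 0] with n hn
  have hn' : (0 : ℝ) < n := by exact_mod_cast hn
  rw [Real.norm_of_nonneg (Real.rpow_nonneg (singularNumber_nonneg _ _) _)]
  -- Dividing by `r + 1` instead of `r` allows `r = 0`.
  set y : ℝ := (n : ℝ) / (r + 1) with hy
  have hy0 : 0 < y := by positivity
  set k := ⌊y ^ (1 / (d : ℝ))⌋₊ with hk
  have hky : (k : ℝ) ≤ y ^ (1 / (d : ℝ)) := Nat.floor_le (by positivity)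
  have hyk : y ^ (1 / (d : ℝ)) ≤ (k : ℝ) + 1 := (Nat.lt_floor_add_one _).le
  have hkn : r * k ^ d ≤ n := by
    have h2 : (k : ℝ) ^ d ≤ y := by
      calc (k : ℝ) ^ d ≤ (y ^ (1 / (d : ℝ))) ^ d := by gcongr
        _ = y := by
          rw [← Real.rpow_natCast, ← Real.rpow_mul hy0.le, one_div_mul_cancel hd'.ne',
            Real.rpow_one]
    have h3 : ((r : ℝ) + 1) * k ^ d ≤ n := by
      rw [hy, le_div_iff₀ (by positivity)] at h2
      linarith
    have h4 : (r : ℝ) * k ^ d ≤ n := by nlinarith [pow_nonneg (Nat.cast_nonneg (α := ℝ) k) d]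
    exact_mod_cast h4
  have h5 : singularNumber (degreeDiagonal d r φ hφ) n ≤ (y ^ (1 / (d : ℝ)))⁻¹ := by
    refine (singularNumber_degreeDiagonal_le hφ hanti h0 hkn).trans ((h1 k).trans ?_)
    rw [one_div]
    exact inv_anti₀ (by positivity) hyk
  calc singularNumber (degreeDiagonal d r φ hφ) n ^ p ≤ ((y ^ (1 / (d : ℝ)))⁻¹) ^ p :=
        Real.rpow_le_rpow (singularNumber_nonneg _ _) h5 hp0.le
    _ = (y ^ (p / d))⁻¹ := by
        rw [Real.inv_rpow (by positivity), ← Real.rpow_mul hy0.le, one_div_mul_eq_div]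
    _ = ((r : ℝ) + 1) ^ (p / d) * (1 / (n : ℝ) ^ (p / d)) := by
        rw [hy, Real.div_rpow hn'.le (by positivity), inv_div]
        ring

end Spaces

/-! ### The isometry of `H²_d ⊗ ℂ^r` into `H²_{d+r}` -/

section Embedding

variable {d r : ℕ}

theorem orthonormal_attachExponent : Orthonormal ℂ fun x : Fin r × (Fin d →₀ ℕ) =>
    (((Real.sqrt (daWeight (attachExponent x)))⁻¹ : ℝ) : ℂ) • monomialH2 (attachExponent x) := by
  classical
  exact orthonormal_of_inner_eq (fun x => daWeight_pos _) fun x y => by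
    rw [inner_monomialH2]
    simp only [attachExponent_injective.eq_iff]

/-- The isometry of `H²_d ⊗ ℂ^r` into `H²_{d+r}` that maps `f` with components homogeneous of
degree `n` to `√(n+1) ∑ j, f_j w_j`. -/
def attachIsometry (d r : ℕ) : DruryArvesonMult d r →L[ℂ] DruryArveson (d + r) :=
  (orthonormal_attachExponent.orthogonalFamily.linearIsometry.comp
    (multBasis d r).repr.toLinearIsometry).toContinuousLinearMap

theorem attachIsometry_monomialH2Mult (x : Fin r × (Fin d →₀ ℕ)) :
    attachIsometry d r (monomialH2Mult x) =
      ((Real.sqrt ((x.2.degree : ℝ) + 1) : ℝ) : ℂ) • monomialH2 (attachExponent x) := by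
  classical
  have h1 : attachIsometry d r (multBasis d r x) =
      (((Real.sqrt (daWeight (attachExponent x)))⁻¹ : ℝ) : ℂ) •
        monomialH2 (attachExponent x) := by
    change orthonormal_attachExponent.orthogonalFamily.linearIsometry
      ((multBasis d r).repr (multBasis d r x)) = _
    rw [HilbertBasis.repr_self, OrthogonalFamily.linearIsometry_apply_single]
    simp
  have h2 : Real.sqrt (daWeight (attachExponent x)) ≠ 0 :=
    (Real.sqrt_pos.mpr (daWeight_pos _)).ne'
  rw [monomialH2Mult_eq, map_smul, h1, smul_smul, ← Complex.ofReal_mul,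
    ← daWeight_attachExponent, Real.sqrt_mul (daWeight_pos _).le]
  congr 2
  field_simp

theorem adjoint_attachIsometry_comp_self :
    (attachIsometry d r).adjoint ∘L attachIsometry d r = 1 :=
  (norm_map_iff_adjoint_comp_self _).mp fun x => LinearIsometry.norm_map
    (orthonormal_attachExponent.orthogonalFamily.linearIsometry.comp
      (multBasis d r).repr.toLinearIsometry) x

theorem adjoint_attachIsometry_apply_self (y : DruryArvesonMult d r) :
    (attachIsometry d r).adjoint (attachIsometry d r y) = y :=
  DFunLike.congr_fun adjoint_attachIsometry_comp_self y

/-- The range of the isometry is spanned by monomials of `w`-degree one, to which all other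
monomials are orthogonal. -/
theorem adjoint_attachIsometry_monomialH2_of_lastDegree_ne_one {γ : Fin (d + r) →₀ ℕ}
    (h : lastDegree γ ≠ 1) : (attachIsometry d r).adjoint (monomialH2 γ) = 0 := by
  classical
  refine (multBasis d r).repr.injective (lp.ext (funext fun x => ?_))
  rw [HilbertBasis.repr_apply_apply, adjoint_inner_right, multBasis_apply, map_smul,
    attachIsometry_monomialH2Mult, inner_smul_left, inner_smul_left, inner_monomialH2,
    if_neg (fun he : attachExponent x = γ => h (he ▸ lastDegree_attachExponent x))]
  rw [mul_zero, mul_zero, map_zero]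
  rfl

theorem attachIsometry_polyToH2Mult {n : ℕ} {f : Fin r → MvPolynomial (Fin d) ℂ}
    (hf : ∀ j, (f j).IsHomogeneous n) : attachIsometry d r (polyToH2Mult d r f) =
      ((Real.sqrt ((n : ℝ) + 1) : ℝ) : ℂ) • polyToH2 (d + r) (attachPoly d r f) :=
  map_eq_of_isHomogeneous (Φ := (attachIsometry d r).toLinearMap ∘ₗ polyToH2Mult d r)
    (Ψ := ((Real.sqrt ((n : ℝ) + 1) : ℝ) : ℂ) • polyToH2 (d + r) ∘ₗ attachPoly d r)
    (fun x hx => by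
      rw [LinearMap.smul_apply, LinearMap.comp_apply, LinearMap.comp_apply,
        attachPoly_vectorMonomial, ← hx]
      exact attachIsometry_monomialH2Mult x) hf

theorem adjoint_attachIsometry_polyToH2 {n : ℕ} {f : Fin r → MvPolynomial (Fin d) ℂ}
    (hf : ∀ j, (f j).IsHomogeneous n) :
    (attachIsometry d r).adjoint (polyToH2 (d + r) (attachPoly d r f)) =
      (((Real.sqrt ((n : ℝ) + 1) : ℝ) : ℂ))⁻¹ • polyToH2Mult d r f := by
  have h : ((Real.sqrt ((n : ℝ) + 1) : ℝ) : ℂ) ≠ 0 := by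
    exact_mod_cast (Real.sqrt_pos.mpr (by positivity)).ne'
  rw [eq_inv_smul_iff₀ h, ← map_smul, ← attachIsometry_polyToH2Mult hf,
    adjoint_attachIsometry_apply_self]

theorem adjoint_attachIsometry_mul_X_mul_X (p : MvPolynomial (Fin (d + r)) ℂ) (j k : Fin r) :
    (attachIsometry d r).adjoint (polyToH2 (d + r)
      (p * (MvPolynomial.X (Fin.natAdd d j) * MvPolynomial.X (Fin.natAdd d k)))) = 0 := by
  have h : (attachIsometry d r).adjoint.toLinearMap ∘ₗ polyToH2 (d + r) ∘ₗ LinearMap.mulRight ℂ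
      (MvPolynomial.X (Fin.natAdd d j) * MvPolynomial.X (Fin.natAdd d k)) = 0 := by
    refine (MvPolynomial.basisMonomials _ ℂ).ext fun γ => ?_
    rw [MvPolynomial.coe_basisMonomials, LinearMap.comp_apply, LinearMap.comp_apply,
      LinearMap.mulRight_apply, MvPolynomial.X, MvPolynomial.X, MvPolynomial.monomial_mul,
      MvPolynomial.monomial_mul, one_mul, one_mul]
    refine adjoint_attachIsometry_monomialH2_of_lastDegree_ne_one ?_
    rw [lastDegree_add, lastDegree_add, lastDegree_single_natAdd, lastDegree_single_natAdd]
    omega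
  exact DFunLike.congr_fun h p

theorem attachExponent_add_single (x : Fin r × (Fin d →₀ ℕ)) (i : Fin d) :
    attachExponent (x.1, x.2 + Finsupp.single i 1) =
      attachExponent x + Finsupp.single (Fin.castAdd r i) 1 := by
  rw [attachExponent, attachExponent, Finsupp.mapDomain_add, Finsupp.mapDomain_single]
  abel

end Embedding

/-! ### The attached quadratic ideal and the invariance of the closures -/

section Invariance

variable {d r : ℕ}

theorem map_mem_of_mem_moduleClosure {F : Type*} [NormedAddCommGroup F] [NormedSpace ℂ F]
    {N : Submodule (MvPolynomial (Fin d) ℂ) (Fin r → MvPolynomial (Fin d) ℂ)}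
    (S : DruryArvesonMult d r →L[ℂ] F) {P : Submodule ℂ F} (hP : IsClosed (P : Set F))
    (h : ∀ f ∈ N, S (polyToH2Mult d r f) ∈ P) : ∀ y ∈ moduleClosure N, S y ∈ P := by
  refine Submodule.topologicalClosure_minimal _ (t := P.comap S.toLinearMap) ?_
    (hP.preimage S.continuous)
  rintro _ ⟨f, hf, rfl⟩
  exact h f hf

theorem map_mem_of_mem_idealClosure {F : Type*} [NormedAddCommGroup F] [NormedSpace ℂ F]
    {I : Ideal (MvPolynomial (Fin d) ℂ)}
    (S : DruryArveson d →L[ℂ] F) {P : Submodule ℂ F} (hP : IsClosed (P : Set F))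
    (h : ∀ f ∈ I, S (polyToH2 d f) ∈ P) : ∀ y ∈ idealClosure I, S y ∈ P := by
  refine Submodule.topologicalClosure_minimal _ (t := P.comap S.toLinearMap) ?_
    (hP.preimage S.continuous)
  rintro _ ⟨f, hf, rfl⟩
  exact h f hf

theorem isClosed_moduleClosure
    (N : Submodule (MvPolynomial (Fin d) ℂ) (Fin r → MvPolynomial (Fin d) ℂ)) :
    IsClosed (moduleClosure N : Set (DruryArvesonMult d r)) :=
  Submodule.isClosed_topologicalClosure _

theorem isClosed_idealClosure (I : Ideal (MvPolynomial (Fin d) ℂ)) :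
    IsClosed (idealClosure I : Set (DruryArveson d)) :=
  Submodule.isClosed_topologicalClosure _

theorem polyToH2Mult_mem_moduleClosure
    {N : Submodule (MvPolynomial (Fin d) ℂ) (Fin r → MvPolynomial (Fin d) ℂ)}
    {f : Fin r → MvPolynomial (Fin d) ℂ} (hf : f ∈ N) : polyToH2Mult d r f ∈ moduleClosure N :=
  Submodule.le_topologicalClosure _ ⟨f, hf, rfl⟩

theorem polyToH2_mem_idealClosure {I : Ideal (MvPolynomial (Fin d) ℂ)}
    {f : MvPolynomial (Fin d) ℂ} (hf : f ∈ I) : polyToH2 d f ∈ idealClosure I :=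
  Submodule.le_topologicalClosure _ ⟨f, hf, rfl⟩

theorem dShiftMult_mem_moduleClosure
    (N : Submodule (MvPolynomial (Fin d) ℂ) (Fin r → MvPolynomial (Fin d) ℂ)) (i : Fin d) :
    ∀ y ∈ moduleClosure N, dShiftMult d r i y ∈ moduleClosure N :=
  map_mem_of_mem_moduleClosure _ (isClosed_moduleClosure N) fun f hf => by
    rw [dShiftMult_polyToH2Mult]
    exact polyToH2Mult_mem_moduleClosure (N.smul_mem _ hf)

theorem dShift_mem_idealClosure (I : Ideal (MvPolynomial (Fin d) ℂ)) (i : Fin d) :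
    ∀ y ∈ idealClosure I, dShift d i y ∈ idealClosure I :=
  map_mem_of_mem_idealClosure _ (isClosed_idealClosure I) fun f hf => by
    rw [dShift_polyToH2]
    exact polyToH2_mem_idealClosure (I.mul_mem_left _ hf)

variable {G : Set (Fin r → MvPolynomial (Fin d) ℂ)}

/-- The quadratic forms `∑ j, g_j w_j`, for `g` in a set `G` of vectors of linear forms in `z`,
together with all products `w_j w_k`. -/
def attachGenerators (G : Set (Fin r → MvPolynomial (Fin d) ℂ)) :
    Set (MvPolynomial (Fin (d + r)) ℂ) :=
  attachPoly d r '' G ∪ Set.range fun jk : Fin r × Fin r =>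
    MvPolynomial.X (Fin.natAdd d jk.1) * MvPolynomial.X (Fin.natAdd d jk.2)

theorem isQuadraticIdeal_span_attachGenerators (hG : ∀ g ∈ G, ∀ j, (g j).IsHomogeneous 1) :
    IsQuadraticIdeal (Ideal.span (attachGenerators G)) := by
  refine ⟨_, ?_, rfl⟩
  rintro _ (⟨g, hg, rfl⟩ | ⟨jk, rfl⟩)
  · exact MvPolynomial.IsHomogeneous.sum _ _ _ fun j _ =>
      (hG g hg j).rename_isHomogeneous.mul (MvPolynomial.isHomogeneous_X _ _)
  · exact (MvPolynomial.isHomogeneous_X _ _).mul (MvPolynomial.isHomogeneous_X _ _)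

theorem isHomogeneous_monomial_smul (hG : ∀ g ∈ G, ∀ j, (g j).IsHomogeneous 1)
    (α : Fin d →₀ ℕ) {g : Fin r → MvPolynomial (Fin d) ℂ} (hg : g ∈ G) (j : Fin r) :
    ((MvPolynomial.monomial α (1 : ℂ) • g) j).IsHomogeneous (α.degree + 1) :=
  (MvPolynomial.isHomogeneous_monomial _ rfl).mul (hG g hg j)

theorem degreeDiagonal_mem_moduleClosure (hG : ∀ g ∈ G, ∀ j, (g j).IsHomogeneous 1)
    {φ : ℕ → ℝ} {B : ℝ} (hφ : ∀ n, |φ n| ≤ B) :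
    ∀ y ∈ moduleClosure (Submodule.span (MvPolynomial (Fin d) ℂ) G),
      degreeDiagonal d r φ hφ y ∈ moduleClosure (Submodule.span (MvPolynomial (Fin d) ℂ) G) :=
  map_mem_of_mem_moduleClosure _ (isClosed_moduleClosure _) fun f hf =>
    map_mem_of_mem_span ((degreeDiagonal d r φ hφ).toLinearMap ∘ₗ polyToH2Mult d r) _
      (fun α g hg => by
        rw [LinearMap.comp_apply, coe_coe,
          degreeDiagonal_polyToH2Mult hφ (isHomogeneous_monomial_smul hG α hg)]
        exact Submodule.smul_mem _ _ (polyToH2Mult_mem_moduleClosure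
          (Submodule.smul_mem _ _ (Submodule.subset_span hg)))) hf

theorem attachIsometry_mem_idealClosure (hG : ∀ g ∈ G, ∀ j, (g j).IsHomogeneous 1) :
    ∀ y ∈ moduleClosure (Submodule.span (MvPolynomial (Fin d) ℂ) G),
      attachIsometry d r y ∈ idealClosure (Ideal.span (attachGenerators G)) :=
  map_mem_of_mem_moduleClosure _ (isClosed_idealClosure _) fun f hf =>
    map_mem_of_mem_span ((attachIsometry d r).toLinearMap ∘ₗ polyToH2Mult d r) _
      (fun α g hg => by
        rw [LinearMap.comp_apply, coe_coe,
          attachIsometry_polyToH2Mult (isHomogeneous_monomial_smul hG α hg), attachPoly_smul]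
        exact Submodule.smul_mem _ _ (polyToH2_mem_idealClosure
          (Ideal.mul_mem_left _ _ (Ideal.subset_span (Or.inl ⟨g, hg, rfl⟩))))) hf

/-- Among the monomial multiples of the generators, those of `w`-degree at least two are killed.
Only `z^α ∑ j, g_j w_j` survives, and it goes to a multiple of `z^α g`. -/
theorem adjoint_attachIsometry_mem_moduleClosure (hG : ∀ g ∈ G, ∀ j, (g j).IsHomogeneous 1) :
    ∀ y ∈ idealClosure (Ideal.span (attachGenerators G)),
      (attachIsometry d r).adjoint y ∈
        moduleClosure (Submodule.span (MvPolynomial (Fin d) ℂ) G) := by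
  refine map_mem_of_mem_idealClosure _ (isClosed_moduleClosure _) fun f hf =>
    map_mem_of_mem_span ((attachIsometry d r).adjoint.toLinearMap ∘ₗ polyToH2 (d + r)) _ ?_ hf
  rintro γ _ (⟨g, hg, rfl⟩ | ⟨jk, rfl⟩)
  · rw [LinearMap.comp_apply, coe_coe, smul_eq_mul]
    rcases eq_or_ne (lastDegree γ) 0 with h | h
    · obtain ⟨α, rfl⟩ := exists_mapDomain_of_lastDegree_eq_zero h
      rw [← MvPolynomial.rename_monomial, ← attachPoly_smul,
        adjoint_attachIsometry_polyToH2 (isHomogeneous_monomial_smul hG α hg)]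
      exact Submodule.smul_mem _ _ (polyToH2Mult_mem_moduleClosure
        (Submodule.smul_mem _ _ (Submodule.subset_span hg)))
    -- A factor `w_k` in the monomial makes every term of the product a multiple of some `w_k w_j`.
    · obtain ⟨k, δ, rfl⟩ := exists_add_single_of_lastDegree_ne_zero h
      have h1 : (MvPolynomial.monomial (δ + Finsupp.single (Fin.natAdd d k) 1) (1 : ℂ)) *
          attachPoly d r g = ∑ j, (MvPolynomial.monomial δ 1 *
            MvPolynomial.rename (Fin.castAdd r) (g j)) *
              (MvPolynomial.X (Fin.natAdd d k) * MvPolynomial.X (Fin.natAdd d j)) := by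
        rw [attachPoly_apply, Finset.mul_sum, MvPolynomial.monomial_add_single, pow_one]
        exact Finset.sum_congr rfl fun j _ => by ring
      rw [h1, map_sum, map_sum, Finset.sum_eq_zero fun j _ =>
        adjoint_attachIsometry_mul_X_mul_X _ _ _]
      exact Submodule.zero_mem _
  · rw [LinearMap.comp_apply, coe_coe, smul_eq_mul, adjoint_attachIsometry_mul_X_mul_X]
    exact Submodule.zero_mem _

end Invariance

/-! ### The weights, their defect, and the commutator formula -/

section Weights

/-- The weights by which the shift on `H²_{d+r}` differs from the one on `H²_d ⊗ ℂ^r` along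
`attachIsometry`. -/
def shiftWeight (n : ℕ) : ℝ := Real.sqrt (((n : ℝ) + 1) / (n + 2))

theorem abs_shiftWeight_le (n : ℕ) : |shiftWeight n| ≤ 1 := by
  rw [shiftWeight, abs_of_nonneg (Real.sqrt_nonneg _), Real.sqrt_le_iff, one_pow,
    div_le_one (by positivity)]
  exact ⟨zero_le_one, by linarith⟩

theorem shiftWeight_mul_self (n : ℕ) :
    shiftWeight n * shiftWeight n = ((n : ℝ) + 1) / (n + 2) :=
  Real.mul_self_sqrt (by positivity)

theorem abs_shiftWeight_pred_le (n : ℕ) : |shiftWeight (n - 1)| ≤ 1 := abs_shiftWeight_le _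

theorem abs_inverseWeight_le (n : ℕ) : |((n : ℝ) + 2) / (n + 1)| ≤ 2 := by
  rw [abs_of_nonneg (by positivity), div_le_iff₀ (by positivity)]
  have : (0 : ℝ) ≤ n := n.cast_nonneg
  linarith

theorem abs_defectWeight_le (n : ℕ) : |1 / ((n : ℝ) + 1) ^ 2| ≤ 1 := by
  have : (0 : ℝ) ≤ n := n.cast_nonneg
  rw [abs_of_nonneg (by positivity), div_le_one (by positivity)]
  nlinarith

variable {d r : ℕ}

theorem dShift_comp_attachIsometry (i : Fin d) :
    dShift (d + r) (Fin.castAdd r i) ∘L attachIsometry d r =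
      attachIsometry d r ∘L dShiftMult d r i ∘L
        degreeDiagonal d r shiftWeight abs_shiftWeight_le := by
  refine clm_ext_monomialH2Mult fun x => ?_
  rw [comp_apply, comp_apply, comp_apply, degreeDiagonal_monomialH2Mult, map_smul, map_smul,
    dShiftMult_monomialH2Mult, attachIsometry_monomialH2Mult, attachIsometry_monomialH2Mult,
    map_smul, dShift_monomialH2, attachExponent_add_single, smul_smul, ← Complex.ofReal_mul,
    map_add, Finsupp.degree_single, shiftWeight, ← Real.sqrt_mul (by positivity)]
  congr 3
  push_cast
  field_simp
  ring

/-- On the range of the isometry `V` this follows from `S_i V = V T_i D` and `V* V = 1`. On the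
other monomials both sides vanish, because multiplication by `z_i` preserves the `w`-degree. -/
theorem adjoint_attachIsometry_comp_dShift (i : Fin d) :
    (attachIsometry d r).adjoint ∘L dShift (d + r) (Fin.castAdd r i) =
      dShiftMult d r i ∘L degreeDiagonal d r shiftWeight abs_shiftWeight_le ∘L
        (attachIsometry d r).adjoint := by
  refine clm_ext_monomialH2 fun γ => ?_
  rw [comp_apply, comp_apply, comp_apply]
  rcases eq_or_ne (lastDegree γ) 1 with h | h
  · obtain ⟨x, rfl⟩ := exists_attachExponent_of_lastDegree_eq_one h
    have h0 : ((Real.sqrt ((x.2.degree : ℝ) + 1) : ℝ) : ℂ) ≠ 0 := by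
      exact_mod_cast (Real.sqrt_pos.mpr (by positivity)).ne'
    rw [(eq_inv_smul_iff₀ h0).mpr (attachIsometry_monomialH2Mult x).symm]
    simp only [map_smul]
    rw [adjoint_attachIsometry_apply_self, ← comp_apply (dShift _ _), dShift_comp_attachIsometry,
      comp_apply, adjoint_attachIsometry_apply_self, comp_apply]
  · rw [dShift_monomialH2, adjoint_attachIsometry_monomialH2_of_lastDegree_ne_one h,
      adjoint_attachIsometry_monomialH2_of_lastDegree_ne_one, map_zero, map_zero]
    rwa [lastDegree_add, lastDegree_single_castAdd, add_zero]

theorem inverseWeight_comp_shiftWeight :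
    degreeDiagonal d r _ abs_inverseWeight_le ∘L
      degreeDiagonal d r shiftWeight abs_shiftWeight_le ∘L
        degreeDiagonal d r shiftWeight abs_shiftWeight_le = 1 := by
  refine clm_ext_monomialH2Mult fun x => ?_
  rw [comp_apply, comp_apply, degreeDiagonal_monomialH2Mult, map_smul,
    degreeDiagonal_monomialH2Mult, map_smul, map_smul, degreeDiagonal_monomialH2Mult, smul_smul,
    smul_smul, ← Complex.ofReal_mul, ← Complex.ofReal_mul, shiftWeight_mul_self]
  have : ((x.2.degree : ℝ) + 1) / (x.2.degree + 2) * ((x.2.degree + 2) / (x.2.degree + 1)) = 1 := by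
    field_simp
  rw [this, Complex.ofReal_one, one_smul]
  rfl

/-- On degree `n` this is `(n+1)/(n+2) · (n+3)/(n+2) + 1/(n+2)² = 1`; the outer weights are
evaluated in degree `n + 1`, after the shift. -/
theorem inverseWeight_comp_dShiftMult_add_defectWeight (i : Fin d) :
    degreeDiagonal d r _ abs_inverseWeight_le ∘L dShiftMult d r i ∘L
      degreeDiagonal d r shiftWeight abs_shiftWeight_le ∘L
        degreeDiagonal d r shiftWeight abs_shiftWeight_le +
      degreeDiagonal d r _ abs_defectWeight_le ∘L dShiftMult d r i = dShiftMult d r i := by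
  refine clm_ext_monomialH2Mult fun x => ?_
  rw [add_apply, comp_apply, comp_apply, comp_apply, comp_apply, degreeDiagonal_monomialH2Mult,
    map_smul, degreeDiagonal_monomialH2Mult, map_smul, map_smul, map_smul, map_smul,
    dShiftMult_monomialH2Mult, degreeDiagonal_monomialH2Mult, degreeDiagonal_monomialH2Mult,
    smul_smul, smul_smul, ← add_smul, ← Complex.ofReal_mul, ← Complex.ofReal_mul,
    shiftWeight_mul_self, ← Complex.ofReal_add, map_add, Finsupp.degree_single]
  have : ((x.2.degree : ℝ) + 1) / (x.2.degree + 2) *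
      ((((x.2.degree + 1 : ℕ) : ℝ) + 2) / (((x.2.degree + 1 : ℕ) : ℝ) + 1)) +
        1 / (((x.2.degree + 1 : ℕ) : ℝ) + 1) ^ 2 = 1 := by
    push_cast
    have : (x.2.degree : ℝ) + 2 ≠ 0 := by positivity
    have h : (x.2.degree : ℝ) + 1 + 1 = x.2.degree + 2 := by ring
    rw [h]
    field_simp
    ring
  rw [this, Complex.ofReal_one, one_smul]

/-- The cross commutators of the closure of a module generated by linear forms, in terms of those
of the closure of the attached ideal. -/
theorem exists_crossCommutator_moduleClosure_eq {G : Set (Fin r → MvPolynomial (Fin d) ℂ)}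
    (hG : ∀ g ∈ G, ∀ j, (g j).IsHomogeneous 1) (i j : Fin d) :
    ∃ (W : moduleClosure (Submodule.span (MvPolynomial (Fin d) ℂ) G) →L[ℂ]
          idealClosure (Ideal.span (attachGenerators G)))
      (X : moduleClosure (Submodule.span (MvPolynomial (Fin d) ℂ) G) →L[ℂ]
          moduleClosure (Submodule.span (MvPolynomial (Fin d) ℂ) G))
      (Y : DruryArvesonMult d r →L[ℂ] moduleClosure (Submodule.span (MvPolynomial (Fin d) ℂ) G)),
      crossCommutator (dShiftMult d r) (moduleClosure (Submodule.span (MvPolynomial (Fin d) ℂ) G))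
          i j =
        W.adjoint ∘L crossCommutator (dShift (d + r)) (idealClosure (Ideal.span (attachGenerators G)))
            (Fin.castAdd r i) (Fin.castAdd r j) ∘L (W ∘L X) +
          Y ∘L degreeDiagonal d r _ abs_defectWeight_le ∘L
            (moduleClosure (Submodule.span (MvPolynomial (Fin d) ℂ) G)).subtypeL := by
  exact exists_crossCommutator_eq_of_weighted_intertwining (dShiftMult d r) (dShift (d + r))
    (Fin.castAdd r) _ _ (attachIsometry d r)
    (degreeDiagonal d r shiftWeight abs_shiftWeight_le)
    (degreeDiagonal d r (fun n => shiftWeight (n - 1)) abs_shiftWeight_pred_le)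
    (degreeDiagonal d r _ abs_inverseWeight_le) (degreeDiagonal d r _ abs_defectWeight_le)
    adjoint_attachIsometry_comp_self (attachIsometry_mem_idealClosure hG)
    (adjoint_attachIsometry_mem_moduleClosure hG) (dShiftMult_mem_moduleClosure _)
    (dShift_mem_idealClosure _) (degreeDiagonal_mem_moduleClosure hG _)
    (adjoint_degreeDiagonal _) (adjoint_degreeDiagonal _) (adjoint_degreeDiagonal _)
    (adjoint_degreeDiagonal _) dShift_comp_attachIsometry adjoint_attachIsometry_comp_dShift
    (dShiftMult_comp_degreeDiagonal _ _ fun n => rfl) inverseWeight_comp_shiftWeight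
    inverseWeight_comp_dShiftMult_add_defectWeight i j

theorem inSchattenClass_defectWeight (hd : 0 < d) {p : ℝ} (hp : (d : ℝ) < p) :
    InSchattenClass p (degreeDiagonal d r _ abs_defectWeight_le) := by
  refine inSchattenClass_degreeDiagonal hd hp abs_defectWeight_le ?_ (fun n => by positivity) ?_
  · intro m n hmn
    have : (m : ℝ) ≤ n := by exact_mod_cast hmn
    dsimp only
    gcongr
  · intro n
    have : (0 : ℝ) ≤ n := n.cast_nonneg
    exact one_div_le_one_div_of_le (by positivity) (by nlinarith)

end Weights

end

theorem mainTheorem4 (d r : ℕ) :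
    (∀ p : ℝ, (d : ℝ) + (r : ℝ) < p →
      (∀ I : Ideal (MvPolynomial (Fin (d + r)) ℂ), IsQuadraticIdeal I →
        IsPEssentiallyNormal p (dShift (d + r)) (idealClosure I)) →
      ∀ N : Submodule (MvPolynomial (Fin d) ℂ) (Fin r → MvPolynomial (Fin d) ℂ),
        IsLinearModule N → IsPEssentiallyNormal p (dShiftMult d r) (moduleClosure N)) ∧
    ((∀ I : Ideal (MvPolynomial (Fin (d + r)) ℂ), IsQuadraticIdeal I →
        IsEssentiallyNormal (dShift (d + r)) (idealClosure I)) →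
      ∀ N : Submodule (MvPolynomial (Fin d) ℂ) (Fin r → MvPolynomial (Fin d) ℂ),
        IsLinearModule N → IsEssentiallyNormal (dShiftMult d r) (moduleClosure N)) := by
  refine ⟨fun p hp hI N hN i j => ?_, fun hI N hN i j => ?_⟩
  · obtain ⟨G, hG, rfl⟩ := hN
    have hd : (d : ℝ) < p := lt_of_le_of_lt (by simp) hp
    have hp0 : 0 < p := lt_of_le_of_lt (by positivity) hd
    obtain ⟨W, X, Y, h⟩ := exists_crossCommutator_moduleClosure_eq hG i j
    rw [h]
    exact ((hI _ (isQuadraticIdeal_span_attachGenerators hG) _ _).comp hp0 _ _).add hp0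
      ((inSchattenClass_defectWeight i.pos hd).comp hp0 _ _)
  · obtain ⟨G, hG, rfl⟩ := hN
    obtain ⟨W, X, Y, h⟩ := exists_crossCommutator_moduleClosure_eq hG i j
    -- Any exponent above `d` gives compactness; `d + 1` is taken. The index `i : Fin d` supplies `0
    -- < d`.
    have hdefect : IsCompactOperator
        (degreeDiagonal d r (fun n => 1 / ((n : ℝ) + 1) ^ 2) abs_defectWeight_le) :=
      (inSchattenClass_defectWeight i.pos (lt_add_one (d : ℝ))).isCompactOperator (by positivity)
    rw [h]
    exact isCompactOperator_comp_add_comp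
      (hI _ (isQuadraticIdeal_span_attachGenerators hG) _ _) hdefect _ _ _ _
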